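/- Let $l>0$, let $V\in L^2[0,l]$ be real-valued, and let $\alpha\in\mathbb R$, $\beta\in\mathbb R\setminus\{0\}$. Consider the square lattice in the plane with nodes $(ml,nl)$, $m,n\in\mathbb Z$, and edges $E_{m,n,r}$ from $(ml,nl)$ to $((m+1)l,nl)$ and $E_{m,n,u}$ from $(ml,nl)$ to $(ml,(n+1)l)$, each identified with $[0,l]$ (with $0$ at $(ml,nl)$). Let $b\in C(\mathbb R^2)$ be real-valued and $l$-periodic in each variable, and put $$\xi=\frac1{2\pi l^2}\int_{[0,l]^2}b\,dx,\qquad \theta=\xi l^2 .$$ Let $A_1,A_2$ be continuous real-valued functions on $\mathbb R^2$, $l$-periodic in each variable, with $\partial_1A_2-\partial_2A_1=b-2\pi\xi$ in the sense of distributions, such that $t\mapsto A_1(t,0)$ and $t\mapsto A_2(0,t)$ belong to $H^1[0,l]$ (as is the case for $C^1$ functions $A_1,A_2$). Let $A(x_1,x_2)=\big(-\pi\xi x_2+A_1(x_1,x_2),\ \pi\xi x_1+A_2(x_1,x_2)\big)$ be the vector potential of $b$, and let $A_{m,n,r}(t)$ be the first component of $A(ml+t,nl)$ and $A_{m,n,u}(t)$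 the second component of $A(ml,nl+t)$, $t\in[0,l]$. In the Hilbert space $\mathcal H=\bigoplus_{(m,n)\in\mathbb Z^2}\big(L^2[0,l]\oplus L^2[0,l]\big)$, with elements $f=(f_{m,n,r},f_{m,n,u})$, let $L$ be the operator acting on each edge as $$f_{m,n,j}\mapsto\Big(-i\frac{d}{dt}-A_{m,n,j}\Big)^2f_{m,n,j}+Vf_{m,n,j},\qquad j\in\{r,u\},$$ whose domain consists of all $f\in\mathcal H$ with $f_{m,n,j}\in H^2[0,l]$ for which the result lies in $\mathcal H$ and which satisfy, for all $m,n\in\mathbb Z$, $$f_{m,n,r}(0)=\tfrac1\beta f_{m,n,u}(0)=f_{m-1,n,r}(l)=\tfrac1\beta f_{m,n-1,u}(l)=:f_{m,n},$$ $$\Big(\frac d{dt}-iA_{m,n,r}\Big)f_{m,n,r}(0)+\beta\Big(\frac d{dt}-iA_{m,n,u}\Big)f_{m,n,u}(0)-\Big(\frac d{dt}-iA_{m-1,n,r}\Big)f_{m-1,n,r}(l)-\beta\Big(\frac d{dt}-iA_{m,n-1,u}\Big)f_{m,n-1,u}(l)=\alpha f_{m,n}.$$ Let $D$ be the operator $Df=-f''+Vf$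 in $L^2[0,l]$ with domain $\{f\in H^2[0,l]: f(0)=f(l)=0\}$. For $z\in\mathbb C$ let $u_1(\cdot;z),u_2(\cdot;z)\in H^2[0,l]$ be the solutions of $-u''+Vu=zu$ with $u_1(0;z)=0$, $u_1'(0;z)=1$, $u_2(0;z)=1$, $u_2'(0;z)=0$, and for $z\notin\operatorname{spec}D$ put $$s(z)=\begin{pmatrix}s_{11}(z)&s_{12}(z)\\ s_{21}(z)&s_{22}(z)\end{pmatrix}=\frac1{u_1(l;z)}\begin{pmatrix}-u_2(l;z)&1\\1&-u_1'(l;z)\end{pmatrix}.$$ Let $M(\theta,\beta)$ be the bounded operator on $\ell^2(\mathbb Z^2)$ given by $$\big(M(\theta,\beta)g\big)_{m,n}=e^{i\pi n\theta}g_{m+1,n}+e^{-i\pi n\theta}g_{m-1,n}+\beta^2\big(e^{-i\pi m\theta}g_{m,n+1}+e^{i\pi m\theta}g_{m,n-1}\big).$$ Then a number $z\in\mathbb R\setminus\operatorname{spec}D$ lies in the spectrum of $L$ if and only if $$0\in\operatorname{spec}\Big[(1+\beta^2)\big(s_{11}(z)+s_{22}(z)\big)-\alpha+s_{12}(z)\,M(\theta,\beta)\Big].$$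 -/

import Mathlib

open MeasureTheory Set

open scoped ContDiff

noncomputable section

namespace QuantumGraph

/-! ### Sobolev functions on the segment `[0, l]` -/

/-- Lebesgue measure on the segment `[0, l]`. -/
abbrev edgeMeasure (l : ℝ) : Measure ℝ := volume.restrict (Icc 0 l)

/-- The derivative of a function on the segment `[0, l]` (one-sided at the end points). -/
def edgeDeriv {E : Type*} [NormedAddCommGroup E] [NormedSpace ℝ E] (l : ℝ) (u : ℝ → E) : ℝ → E :=
  derivWithin u (Icc 0 l)

/-- `u` is (the continuous representative of) an element of `H¹[0, l]`: it is absolutely continuous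
on `[0, l]` with a derivative in `L²`, i.e. it is a primitive of an `L²` function. -/
def MemH1 {E : Type*} [NormedAddCommGroup E] [NormedSpace ℝ E] (l : ℝ) (u : ℝ → E) : Prop :=
  ∃ v : ℝ → E, MemLp v 2 (edgeMeasure l) ∧ ∀ t ∈ Icc 0 l, u t = u 0 + ∫ s in (0 : ℝ)..t, v s

/-- `u` is (the `C¹` representative of) an element of `H²[0, l]`. -/
def MemH2 (l : ℝ) (u : ℝ → ℂ) : Prop :=
  DifferentiableOn ℝ u (Icc 0 l) ∧ MemH1 l (edgeDeriv l u)

theorem MemH1.ae_differentiable {E : Type*} [NormedAddCommGroup E] [NormedSpace ℝ E]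
    [CompleteSpace E] {l : ℝ} {u : ℝ → E} (h : MemH1 l u) :
    ∀ᵐ t ∂(edgeMeasure l), DifferentiableWithinAt ℝ u (Icc 0 l) t := by
  obtain ⟨v, hv, hu⟩ := h
  rcases lt_or_ge l 0 with hl | hl
  · simp [edgeMeasure, Icc_eq_empty (not_le.mpr hl)]
  have hint : IntervalIntegrable v volume 0 l := by
    rw [intervalIntegrable_iff_integrableOn_Icc_of_le hl]
    exact hv.integrable (by norm_num)
  rw [ae_restrict_iff' measurableSet_Icc]
  filter_upwards [hint.ae_hasDerivAt_integral] with t ht htI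
  rw [uIcc_of_le hl] at ht
  have h1 := (ht htI 0 ⟨le_rfl, hl⟩).differentiableAt.differentiableWithinAt (s := Icc 0 l)
  exact (h1.const_add (u 0)).congr (fun s hs => hu s hs) (hu t htI)

theorem edgeDeriv_congr {E : Type*} [NormedAddCommGroup E] [NormedSpace ℝ E] {l : ℝ}
    {u v : ℝ → E} (h : EqOn u v (Icc 0 l)) : EqOn (edgeDeriv l u) (edgeDeriv l v) (Icc 0 l) :=
  fun _ ht => derivWithin_congr h (h ht)

theorem MemH1.congr {E : Type*} [NormedAddCommGroup E] [NormedSpace ℝ E] {l : ℝ}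
    {u v : ℝ → E} (hu : MemH1 l u) (h : EqOn v u (Icc 0 l)) : MemH1 l v := by
  obtain ⟨w, hw, hw'⟩ := hu
  refine ⟨w, hw, fun t ht => ?_⟩
  rw [h ht, h ⟨le_rfl, ht.1.trans ht.2⟩, hw' t ht]

theorem MemH1.const_add {E : Type*} [NormedAddCommGroup E] [NormedSpace ℝ E] {l : ℝ}
    {u : ℝ → E} (hu : MemH1 l u) (c : E) : MemH1 l (fun t => c + u t) := by
  obtain ⟨w, hw, hw'⟩ := hu
  refine ⟨w, hw, fun t ht => ?_⟩
  change c + u t = c + u 0 + _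
  rw [hw' t ht, add_assoc]

theorem MemH1.add {l : ℝ} {u v : ℝ → ℂ} (hu : MemH1 l u) (hv : MemH1 l v) :
    MemH1 l (u + v) := by
  obtain ⟨w, hw, hw'⟩ := hu
  obtain ⟨x, hx, hx'⟩ := hv
  refine ⟨w + x, hw.add hx, fun t ht => ?_⟩
  have hi : ∀ f : ℝ → ℂ, MemLp f 2 (edgeMeasure l) → IntervalIntegrable f volume 0 t := by
    intro f hf
    rw [intervalIntegrable_iff_integrableOn_Icc_of_le ht.1]
    have h1 : IntegrableOn f (Icc 0 l) volume := hf.integrable (by norm_num)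
    exact h1.mono_set (Icc_subset_Icc le_rfl ht.2)
  simp only [Pi.add_apply]
  rw [intervalIntegral.integral_add (hi w hw) (hi x hx), hw' t ht, hx' t ht]
  ring

theorem MemH1.smul {l : ℝ} {u : ℝ → ℂ} (hu : MemH1 l u) (c : ℂ) : MemH1 l (c • u) := by
  obtain ⟨w, hw, hw'⟩ := hu
  refine ⟨c • w, hw.const_smul c, fun t ht => ?_⟩
  simp only [Pi.smul_apply]
  rw [intervalIntegral.integral_smul, hw' t ht, smul_add]

theorem edgeDeriv_add {l : ℝ} {u v : ℝ → ℂ} (hu : DifferentiableOn ℝ u (Icc 0 l))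
    (hv : DifferentiableOn ℝ v (Icc 0 l)) :
    EqOn (edgeDeriv l (u + v)) (edgeDeriv l u + edgeDeriv l v) (Icc 0 l) :=
  fun t ht => derivWithin_add (hu t ht) (hv t ht)

theorem edgeDeriv_smul {l : ℝ} {u : ℝ → ℂ} (hu : DifferentiableOn ℝ u (Icc 0 l)) (c : ℂ) :
    EqOn (edgeDeriv l (c • u)) (c • edgeDeriv l u) (Icc 0 l) :=
  fun t ht => derivWithin_const_smul c (hu t ht)

theorem MemH2.add {l : ℝ} {u v : ℝ → ℂ} (hu : MemH2 l u) (hv : MemH2 l v) : MemH2 l (u + v) :=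
  ⟨hu.1.add hv.1, (hu.2.add hv.2).congr (edgeDeriv_add hu.1 hv.1)⟩

theorem MemH2.smul {l : ℝ} {u : ℝ → ℂ} (hu : MemH2 l u) (c : ℂ) : MemH2 l (c • u) :=
  ⟨hu.1.const_smul c, (hu.2.smul c).congr (edgeDeriv_smul hu.1 c)⟩

/-! ### The differential expressions on an edge -/

/-- The kinetic momentum `(-i d/dt - A) u`. -/
def momentum (l : ℝ) (A : ℝ → ℝ) (u : ℝ → ℂ) : ℝ → ℂ :=
  fun t => -Complex.I * edgeDeriv l u t - (A t : ℂ) * u t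

/-- The magnetic Schrödinger expression `(-i d/dt - A)² u + V u`. -/
def magneticSchrodinger (l : ℝ) (A V : ℝ → ℝ) (u : ℝ → ℂ) : ℝ → ℂ :=
  fun t => momentum l A (momentum l A u) t + (V t : ℂ) * u t

/-- The magnetic derivative `(d/dt - i A) u`. -/
def covDeriv (l : ℝ) (A : ℝ → ℝ) (u : ℝ → ℂ) : ℝ → ℂ :=
  fun t => edgeDeriv l u t - Complex.I * (A t : ℂ) * u t

/-- The Schrödinger expression `-u'' + V u` without magnetic field. -/
def schrodinger (l : ℝ) (V : ℝ → ℝ) (u : ℝ → ℂ) : ℝ → ℂ :=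
  fun t => -edgeDeriv l (edgeDeriv l u) t + (V t : ℂ) * u t

theorem momentum_congr {l : ℝ} {A : ℝ → ℝ} {u v : ℝ → ℂ} (h : EqOn u v (Icc 0 l)) :
    EqOn (momentum l A u) (momentum l A v) (Icc 0 l) := fun t ht => by
  simp only [momentum, h ht, edgeDeriv_congr h ht]

theorem magneticSchrodinger_congr {l : ℝ} {A V : ℝ → ℝ} {u v : ℝ → ℂ} (h : EqOn u v (Icc 0 l)) :
    EqOn (magneticSchrodinger l A V u) (magneticSchrodinger l A V v) (Icc 0 l) := fun t ht => by
  simp only [magneticSchrodinger, h ht, momentum_congr (momentum_congr h) ht]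

theorem schrodinger_congr {l : ℝ} {V : ℝ → ℝ} {u v : ℝ → ℂ} (h : EqOn u v (Icc 0 l)) :
    EqOn (schrodinger l V u) (schrodinger l V v) (Icc 0 l) := fun t ht => by
  simp only [schrodinger, h ht, edgeDeriv_congr (edgeDeriv_congr h) ht]

theorem covDeriv_add {l : ℝ} {A : ℝ → ℝ} {u v : ℝ → ℂ} (hu : MemH2 l u) (hv : MemH2 l v) :
    EqOn (covDeriv l A (u + v)) (covDeriv l A u + covDeriv l A v) (Icc 0 l) := fun t ht => by
  simp only [covDeriv, edgeDeriv_add hu.1 hv.1 ht, Pi.add_apply]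
  ring

theorem covDeriv_smul {l : ℝ} {A : ℝ → ℝ} {u : ℝ → ℂ} (hu : MemH2 l u) (c : ℂ) :
    EqOn (covDeriv l A (c • u)) (c • covDeriv l A u) (Icc 0 l) := fun t ht => by
  simp only [covDeriv, edgeDeriv_smul hu.1 c ht, Pi.smul_apply, smul_eq_mul]
  ring

theorem momentum_add {l : ℝ} {A : ℝ → ℝ} {u v : ℝ → ℂ} (hu : MemH2 l u) (hv : MemH2 l v) :
    EqOn (momentum l A (u + v)) (momentum l A u + momentum l A v) (Icc 0 l) := fun t ht => by
  simp only [momentum, edgeDeriv_add hu.1 hv.1 ht, Pi.add_apply]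
  ring

theorem momentum_smul {l : ℝ} {A : ℝ → ℝ} {u : ℝ → ℂ} (hu : MemH2 l u) (c : ℂ) :
    EqOn (momentum l A (c • u)) (c • momentum l A u) (Icc 0 l) := fun t ht => by
  simp only [momentum, edgeDeriv_smul hu.1 c ht, Pi.smul_apply, smul_eq_mul]
  ring

theorem ae_mem_edge (l : ℝ) : ∀ᵐ t ∂(edgeMeasure l), t ∈ Icc 0 l :=
  ae_restrict_mem measurableSet_Icc

theorem ae_differentiable_momentum {l : ℝ} {A : ℝ → ℝ} (hA : MemH1 l A) {u : ℝ → ℂ}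
    (hu : MemH2 l u) :
    ∀ᵐ t ∂(edgeMeasure l), DifferentiableWithinAt ℝ (momentum l A u) (Icc 0 l) t := by
  filter_upwards [hA.ae_differentiable, hu.2.ae_differentiable, ae_mem_edge l] with t h1 h2 ht
  have h3 : DifferentiableWithinAt ℝ (fun s => (A s : ℂ)) (Icc 0 l) t :=
    Complex.ofRealCLM.differentiableAt.comp_differentiableWithinAt t h1
  exact (h2.const_mul _).sub (h3.mul (hu.1 t ht))

theorem magneticSchrodinger_add {l : ℝ} {A V : ℝ → ℝ} (hA : MemH1 l A) {u v : ℝ → ℂ}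
    (hu : MemH2 l u) (hv : MemH2 l v) :
    magneticSchrodinger l A V (u + v) =ᵐ[edgeMeasure l]
      magneticSchrodinger l A V u + magneticSchrodinger l A V v := by
  filter_upwards [ae_differentiable_momentum hA hu, ae_differentiable_momentum hA hv,
    ae_mem_edge l] with t h1 h2 ht
  have h3 := momentum_congr (A := A) (momentum_add (A := A) hu hv) ht
  have h4 : edgeDeriv l (momentum l A u + momentum l A v) t
      = edgeDeriv l (momentum l A u) t + edgeDeriv l (momentum l A v) t := derivWithin_add h1 h2
  simp only [magneticSchrodinger, h3, Pi.add_apply]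
  rw [momentum, h4]
  simp only [momentum, Pi.add_apply]
  ring

theorem magneticSchrodinger_smul {l : ℝ} {A V : ℝ → ℝ} (hA : MemH1 l A) {u : ℝ → ℂ}
    (hu : MemH2 l u) (c : ℂ) :
    magneticSchrodinger l A V (c • u) =ᵐ[edgeMeasure l] c • magneticSchrodinger l A V u := by
  filter_upwards [ae_differentiable_momentum hA hu, ae_mem_edge l] with t h1 ht
  have h3 := momentum_congr (A := A) (momentum_smul (A := A) hu c) ht
  have h4 : edgeDeriv l (c • momentum l A u) t = c • edgeDeriv l (momentum l A u) t :=
    derivWithin_const_smul c h1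
  simp only [magneticSchrodinger, h3, Pi.smul_apply]
  rw [momentum, h4]
  simp only [momentum, Pi.smul_apply, smul_eq_mul]
  ring

theorem schrodinger_add {l : ℝ} {V : ℝ → ℝ} {u v : ℝ → ℂ} (hu : MemH2 l u) (hv : MemH2 l v) :
    schrodinger l V (u + v) =ᵐ[edgeMeasure l] schrodinger l V u + schrodinger l V v := by
  filter_upwards [hu.2.ae_differentiable, hv.2.ae_differentiable, ae_mem_edge l] with t h1 h2 ht
  have h3 := edgeDeriv_congr (edgeDeriv_add hu.1 hv.1) ht
  have h4 : edgeDeriv l (edgeDeriv l u + edgeDeriv l v) t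
      = edgeDeriv l (edgeDeriv l u) t + edgeDeriv l (edgeDeriv l v) t := derivWithin_add h1 h2
  simp only [schrodinger, h3, h4, Pi.add_apply]
  ring

theorem schrodinger_smul {l : ℝ} {V : ℝ → ℝ} {u : ℝ → ℂ} (hu : MemH2 l u) (c : ℂ) :
    schrodinger l V (c • u) =ᵐ[edgeMeasure l] c • schrodinger l V u := by
  filter_upwards [hu.2.ae_differentiable, ae_mem_edge l] with t h1 ht
  have h3 := edgeDeriv_congr (edgeDeriv_smul hu.1 c) ht
  have h4 : edgeDeriv l (c • edgeDeriv l u) t = c • edgeDeriv l (edgeDeriv l u) t :=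
    derivWithin_const_smul c h1
  simp only [schrodinger, h3, h4, Pi.smul_apply, smul_eq_mul]
  ring

theorem edgeDeriv_zero (l : ℝ) : edgeDeriv l (0 : ℝ → ℂ) = 0 := by
  funext t
  simp [edgeDeriv]

theorem momentum_zero (l : ℝ) (A : ℝ → ℝ) : momentum l A 0 = 0 := by
  funext t
  simp [momentum, edgeDeriv_zero]

theorem memH2_zero (l : ℝ) : MemH2 l 0 := by
  refine ⟨differentiableOn_const 0, 0, MemLp.zero, fun t _ => ?_⟩
  simp [edgeDeriv_zero]

theorem eqOn_of_ae_eq {l : ℝ} (hl : 0 < l) {u v : ℝ → ℂ} (hu : MemH2 l u) (hv : MemH2 l v)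
    (h : u =ᵐ[edgeMeasure l] v) : EqOn u v (Icc 0 l) :=
  Measure.eqOn_Icc_of_ae_eq volume hl.ne h hu.1.continuousOn hv.1.continuousOn

/-! ### The lattice, the magnetic field and its vector potential -/

/-- The two directions of the edges. -/
inductive Dir
  | right
  | up

/-- The edge `(m, n, right)` joins the node `(m l, n l)` to `((m + 1) l, n l)`; the edge
`(m, n, up)` joins `(m l, n l)` to `(m l, (n + 1) l)`. -/
abbrev Edge : Type := ℤ × ℤ × Dir

/-- `L²[0, l]`. -/
abbrev EdgeSpace (l : ℝ) : Type := Lp ℂ 2 (edgeMeasure l)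

/-- The Hilbert sum of the spaces `L²[0, l]` over all edges. -/
abbrev LatticeSpace (l : ℝ) : Type := lp (fun _ : Edge => EdgeSpace l) 2

/-- `ξ = (2 π l²)⁻¹ ∫_F b`, where `F` is the fundamental cell `[0, l] × [0, l]`. -/
def fluxDensity (l : ℝ) (b : ℝ × ℝ → ℝ) : ℝ :=
  1 / (2 * Real.pi * l ^ 2) * ∫ x in Icc (0 : ℝ) l ×ˢ Icc (0 : ℝ) l, b x

/-- A continuous magnetic field `b`, `l`-periodic in both variables, together with a continuous
`l`-periodic vector potential `(A₁, A₂)` of its zero-mean part `b - 2 π ξ`. The equation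
`∂₁ A₂ - ∂₂ A₁ = b - 2 π ξ` is meant in the sense of distributions. The traces of the potential on
the edges belong to `H¹`, so that `(-i d/dt - A)²` makes sense on `H²[0, l]`; this is automatic
for a `C¹` potential. -/
structure PeriodicMagneticField (l : ℝ) where
  b : ℝ × ℝ → ℝ
  b_continuous : Continuous b
  b_periodic_fst : ∀ x y, b (x + l, y) = b (x, y)
  b_periodic_snd : ∀ x y, b (x, y + l) = b (x, y)
  A₁ : ℝ × ℝ → ℝ
  A₂ : ℝ × ℝ → ℝ
  A₁_continuous : Continuous A₁
  A₂_continuous : Continuous A₂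
  A₁_periodic_fst : ∀ x y, A₁ (x + l, y) = A₁ (x, y)
  A₁_periodic_snd : ∀ x y, A₁ (x, y + l) = A₁ (x, y)
  A₂_periodic_fst : ∀ x y, A₂ (x + l, y) = A₂ (x, y)
  A₂_periodic_snd : ∀ x y, A₂ (x, y + l) = A₂ (x, y)
  curl_eq : ∀ φ : ℝ × ℝ → ℝ, ContDiff ℝ ∞ φ → HasCompactSupport φ →
    ∫ x, (A₁ x * fderiv ℝ φ x (0, 1) - A₂ x * fderiv ℝ φ x (1, 0))
      = ∫ x, (b x - 2 * Real.pi * fluxDensity l b) * φ x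
  trace_right : MemH1 l (fun t => A₁ (t, 0))
  trace_up : MemH1 l (fun t => A₂ (0, t))

namespace PeriodicMagneticField

variable {l : ℝ}

/-- The mean flux density `ξ`. -/
def xi (F : PeriodicMagneticField l) : ℝ := fluxDensity l F.b

/-- The number `θ = ξ l²` of flux quanta through the elementary cell. -/
def theta (F : PeriodicMagneticField l) : ℝ := F.xi * l ^ 2

/-- The vector potential `A(x) = ½ B₀ × x + (A₁, A₂)`, `B₀ = (0, 0, 2 π ξ)`, in the plane. -/
def potential (F : PeriodicMagneticField l) (x : ℝ × ℝ) : ℝ × ℝ :=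
  (-(Real.pi * F.xi * x.2) + F.A₁ x, Real.pi * F.xi * x.1 + F.A₂ x)

/-- The magnetic potential on an edge: the tangential component of the vector potential. -/
def edgePotential (F : PeriodicMagneticField l) : Edge → ℝ → ℝ
  | (m, n, Dir.right) => fun t => (F.potential (m * l + t, n * l)).1
  | (m, n, Dir.up) => fun t => (F.potential (m * l, n * l + t)).2

theorem edgePotential_right (F : PeriodicMagneticField l) (m n : ℤ) (t : ℝ) :
    F.edgePotential (m, n, Dir.right) t = -(Real.pi * F.xi * (n * l)) + F.A₁ (t, 0) := by
  have h1 : Function.Periodic (fun x => F.A₁ (x, n * l)) l := fun x => F.A₁_periodic_fst x _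
  have h2 : Function.Periodic (fun y => F.A₁ (t, y)) l := fun y => F.A₁_periodic_snd t y
  have h3 := h1.int_mul m t
  have h4 := h2.int_mul n 0
  simp only [zero_add] at h3 h4
  simp only [edgePotential, potential]
  rw [add_comm ((m : ℝ) * l) t, h3, h4]

theorem edgePotential_up (F : PeriodicMagneticField l) (m n : ℤ) (t : ℝ) :
    F.edgePotential (m, n, Dir.up) t = Real.pi * F.xi * (m * l) + F.A₂ (0, t) := by
  have h1 : Function.Periodic (fun y => F.A₂ (m * l, y)) l := fun y => F.A₂_periodic_snd _ y
  have h2 : Function.Periodic (fun x => F.A₂ (x, t)) l := fun x => F.A₂_periodic_fst x t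
  have h3 := h1.int_mul n t
  have h4 := h2.int_mul m 0
  simp only [zero_add] at h3 h4
  simp only [edgePotential, potential]
  rw [add_comm ((n : ℝ) * l) t, h3, h4]

theorem memH1_edgePotential (F : PeriodicMagneticField l) (e : Edge) :
    MemH1 l (F.edgePotential e) := by
  obtain ⟨m, n, d⟩ := e
  cases d
  · exact (F.trace_right.const_add _).congr fun t _ => F.edgePotential_right m n t
  · exact (F.trace_up.const_add _).congr fun t _ => F.edgePotential_up m n t

end PeriodicMagneticField

/-! ### The magnetic Hamiltonian of the lattice -/

/-- The boundary conditions at the nodes: the `δ`-like interaction with parameters `α`, `β`.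
The common value `f_{m,n}` at the node is written as the value of the right edge. -/
structure VertexConditions {l : ℝ} (F : PeriodicMagneticField l) (α β : ℝ)
    (u : Edge → ℝ → ℂ) : Prop where
  up_start : ∀ m n : ℤ, 1 / (β : ℂ) * u (m, n, Dir.up) 0 = u (m, n, Dir.right) 0
  right_end : ∀ m n : ℤ, u (m - 1, n, Dir.right) l = u (m, n, Dir.right) 0
  up_end : ∀ m n : ℤ, 1 / (β : ℂ) * u (m, n - 1, Dir.up) l = u (m, n, Dir.right) 0
  flux : ∀ m n : ℤ,
    covDeriv l (F.edgePotential (m, n, Dir.right)) (u (m, n, Dir.right)) 0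
      + β * covDeriv l (F.edgePotential (m, n, Dir.up)) (u (m, n, Dir.up)) 0
      - covDeriv l (F.edgePotential (m - 1, n, Dir.right)) (u (m - 1, n, Dir.right)) l
      - β * covDeriv l (F.edgePotential (m, n - 1, Dir.up)) (u (m, n - 1, Dir.up)) l
    = α * u (m, n, Dir.right) 0

/-- `(f, g)` is in the graph of the lattice Hamiltonian: the components of `f` are `H²` functions
`u e` satisfying the boundary conditions, and the components of `g` are
`(-i d/dt - A_e)² u_e + V u_e`. -/
def IsHamiltonianPair {l : ℝ} (F : PeriodicMagneticField l) (V : ℝ → ℝ) (α β : ℝ)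
    (f g : LatticeSpace l) : Prop :=
  ∃ u : Edge → ℝ → ℂ,
    (∀ e, MemH2 l (u e)) ∧
    VertexConditions F α β u ∧
    (∀ e, f e =ᵐ[edgeMeasure l] u e) ∧
    (∀ e, g e =ᵐ[edgeMeasure l] magneticSchrodinger l (F.edgePotential e) V (u e))

theorem VertexConditions.add {l : ℝ} (hl : 0 ≤ l) {F : PeriodicMagneticField l} {α β : ℝ}
    {u v : Edge → ℝ → ℂ} (hu2 : ∀ e, MemH2 l (u e)) (hv2 : ∀ e, MemH2 l (v e))
    (hu : VertexConditions F α β u) (hv : VertexConditions F α β v) :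
    VertexConditions F α β (fun e => u e + v e) where
  up_start m n := by simp only [Pi.add_apply, mul_add, hu.up_start, hv.up_start]
  right_end m n := by simp only [Pi.add_apply, hu.right_end, hv.right_end]
  up_end m n := by simp only [Pi.add_apply, mul_add, hu.up_end, hv.up_end]
  flux m n := by
    have h0 : (0 : ℝ) ∈ Icc 0 l := ⟨le_rfl, hl⟩
    have h1 : l ∈ Icc 0 l := ⟨hl, le_rfl⟩
    simp only [covDeriv_add (hu2 _) (hv2 _) h0, covDeriv_add (hu2 _) (hv2 _) h1, Pi.add_apply]
    linear_combination hu.flux m n + hv.flux m n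

theorem VertexConditions.smul {l : ℝ} (hl : 0 ≤ l) {F : PeriodicMagneticField l} {α β : ℝ}
    {u : Edge → ℝ → ℂ} (hu2 : ∀ e, MemH2 l (u e))
    (hu : VertexConditions F α β u) (c : ℂ) :
    VertexConditions F α β (fun e => c • u e) where
  up_start m n := by
    simp only [Pi.smul_apply, smul_eq_mul]
    linear_combination c * hu.up_start m n
  right_end m n := by simp only [Pi.smul_apply, hu.right_end]
  up_end m n := by
    simp only [Pi.smul_apply, smul_eq_mul]
    linear_combination c * hu.up_end m n
  flux m n := by
    have h0 : (0 : ℝ) ∈ Icc 0 l := ⟨le_rfl, hl⟩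
    have h1 : l ∈ Icc 0 l := ⟨hl, le_rfl⟩
    simp only [covDeriv_smul (hu2 _) c h0, covDeriv_smul (hu2 _) c h1, Pi.smul_apply, smul_eq_mul]
    linear_combination c * hu.flux m n

/-- The graph of the lattice Hamiltonian as a linear subspace. -/
def hamiltonianGraph {l : ℝ} (hl : 0 < l) (F : PeriodicMagneticField l) (V : ℝ → ℝ) (α β : ℝ) :
    Submodule ℂ (LatticeSpace l × LatticeSpace l) where
  carrier := {p | IsHamiltonianPair F V α β p.1 p.2}
  zero_mem' := by
    refine ⟨fun _ => 0, fun _ => memH2_zero l, ⟨?_, ?_, ?_, ?_⟩, fun e => ?_, fun e => ?_⟩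
    · simp
    · simp
    · simp
    · simp [covDeriv, edgeDeriv_zero]
    · exact Lp.coeFn_zero ℂ 2 (edgeMeasure l)
    · refine (Lp.coeFn_zero ℂ 2 (edgeMeasure l)).trans (Filter.Eventually.of_forall fun t => ?_)
      simp [magneticSchrodinger, momentum_zero]
  add_mem' := by
    rintro ⟨f, g⟩ ⟨f', g'⟩ ⟨u, hu, hb, hf, hg⟩ ⟨u', hu', hb', hf', hg'⟩
    refine ⟨fun e => u e + u' e, fun e => (hu e).add (hu' e), hb.add hl.le hu hu' hb',
      fun e => ?_, fun e => ?_⟩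
    · exact (Lp.coeFn_add (f e) (f' e)).trans ((hf e).add (hf' e))
    · exact ((Lp.coeFn_add (g e) (g' e)).trans ((hg e).add (hg' e))).trans
        (magneticSchrodinger_add (F.memH1_edgePotential e) (hu e) (hu' e)).symm
  smul_mem' := by
    rintro c ⟨f, g⟩ ⟨u, hu, hb, hf, hg⟩
    refine ⟨fun e => c • u e, fun e => (hu e).smul c, hb.smul hl.le hu c, fun e => ?_, fun e => ?_⟩
    · exact (Lp.coeFn_smul c (f e)).trans ((hf e).const_smul c)
    · exact ((Lp.coeFn_smul c (g e)).trans ((hg e).const_smul c)).trans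
        (magneticSchrodinger_smul (F.memH1_edgePotential e) (hu e) c).symm

/-- The magnetic Hamiltonian `L` of the lattice, an unbounded operator. -/
def hamiltonian {l : ℝ} (hl : 0 < l) (F : PeriodicMagneticField l) (V : ℝ → ℝ) (α β : ℝ) :
    LatticeSpace l →ₗ.[ℂ] LatticeSpace l :=
  (hamiltonianGraph hl F V α β).toLinearPMap

theorem hamiltonian_graph {l : ℝ} (hl : 0 < l) (F : PeriodicMagneticField l) (V : ℝ → ℝ)
    (α β : ℝ) : (hamiltonian hl F V α β).graph = hamiltonianGraph hl F V α β := by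
  refine Submodule.toLinearPMap_graph_eq _ ?_
  rintro ⟨f, g⟩ ⟨u, hu, -, hf, hg⟩ (h0 : f = 0)
  subst h0
  refine lp.ext (funext fun e => Lp.ext ?_)
  have h1 : EqOn (u e) 0 (Icc 0 l) := by
    refine eqOn_of_ae_eq hl (hu e) (memH2_zero l) ?_
    exact (hf e).symm.trans (Lp.coeFn_zero ℂ 2 (edgeMeasure l))
  refine (hg e).trans (Filter.EventuallyEq.trans ?_ (Lp.coeFn_zero ℂ 2 (edgeMeasure l)).symm)
  filter_upwards [ae_mem_edge l] with t ht
  rw [magneticSchrodinger_congr h1 ht]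
  simp [magneticSchrodinger, momentum_zero]

/-! ### The Dirichlet operator on an edge -/

/-- `(f, g)` is in the graph of the Dirichlet operator `D`. -/
def IsDirichletPair {l : ℝ} (V : ℝ → ℝ) (f g : EdgeSpace l) : Prop :=
  ∃ u : ℝ → ℂ, MemH2 l u ∧ u 0 = 0 ∧ u l = 0 ∧ f =ᵐ[edgeMeasure l] u ∧
    g =ᵐ[edgeMeasure l] schrodinger l V u

/-- The graph of the Dirichlet operator as a linear subspace. -/
def dirichletGraph (l : ℝ) (V : ℝ → ℝ) : Submodule ℂ (EdgeSpace l × EdgeSpace l) where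
  carrier := {p | IsDirichletPair V p.1 p.2}
  zero_mem' := by
    refine ⟨0, memH2_zero l, rfl, rfl, Lp.coeFn_zero ℂ 2 (edgeMeasure l), ?_⟩
    refine (Lp.coeFn_zero ℂ 2 (edgeMeasure l)).trans (Filter.Eventually.of_forall fun t => ?_)
    simp [schrodinger, edgeDeriv_zero]
  add_mem' := by
    rintro ⟨f, g⟩ ⟨f', g'⟩ ⟨u, hu, h0, h1, hf, hg⟩ ⟨u', hu', h0', h1', hf', hg'⟩
    refine ⟨u + u', hu.add hu', by simp [h0, h0'], by simp [h1, h1'], ?_, ?_⟩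
    · exact (Lp.coeFn_add f f').trans (hf.add hf')
    · exact ((Lp.coeFn_add g g').trans (hg.add hg')).trans (schrodinger_add hu hu').symm
  smul_mem' := by
    rintro c ⟨f, g⟩ ⟨u, hu, h0, h1, hf, hg⟩
    refine ⟨c • u, hu.smul c, by simp [h0], by simp [h1], ?_, ?_⟩
    · exact (Lp.coeFn_smul c f).trans (hf.const_smul c)
    · exact ((Lp.coeFn_smul c g).trans (hg.const_smul c)).trans (schrodinger_smul hu c).symm

/-- The Dirichlet operator `D f = -f'' + V f`, `f ∈ H²[0, l]`, `f(0) = f(l) = 0`. -/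
def dirichletOperator (l : ℝ) (V : ℝ → ℝ) : EdgeSpace l →ₗ.[ℂ] EdgeSpace l :=
  (dirichletGraph l V).toLinearPMap

theorem dirichletOperator_graph {l : ℝ} (hl : 0 < l) (V : ℝ → ℝ) :
    (dirichletOperator l V).graph = dirichletGraph l V := by
  refine Submodule.toLinearPMap_graph_eq _ ?_
  rintro ⟨f, g⟩ ⟨u, hu, -, -, hf, hg⟩ (h0 : f = 0)
  subst h0
  refine Lp.ext ?_
  have h1 : EqOn u 0 (Icc 0 l) := by
    refine eqOn_of_ae_eq hl hu (memH2_zero l) ?_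
    exact hf.symm.trans (Lp.coeFn_zero ℂ 2 (edgeMeasure l))
  refine hg.trans (Filter.EventuallyEq.trans ?_ (Lp.coeFn_zero ℂ 2 (edgeMeasure l)).symm)
  filter_upwards [ae_mem_edge l] with t ht
  rw [schrodinger_congr h1 ht]
  simp [schrodinger, edgeDeriv_zero]

/-! ### The spectrum of an unbounded operator -/

/-- The resolvent set of an unbounded operator `T`: the numbers `z` for which `T - z` maps the
domain of `T` bijectively onto the whole space, with a bounded inverse `R`. -/
def resolventSet {H : Type*} [NormedAddCommGroup H] [NormedSpace ℂ H] (T : H →ₗ.[ℂ] H) : Set ℂ :=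
  {z | ∃ R : H →L[ℂ] H, (∀ x : T.domain, R (T x - z • (x : H)) = x) ∧
    ∀ y : H, ∃ h : R y ∈ T.domain, T ⟨R y, h⟩ - z • R y = y}

/-- The spectrum of an unbounded operator. -/
def unboundedSpectrum {H : Type*} [NormedAddCommGroup H] [NormedSpace ℂ H] (T : H →ₗ.[ℂ] H) :
    Set ℂ :=
  (resolventSet T)ᶜ

/-! ### The Krein matrix of an edge -/

/-- `u ∈ H²[0, l]`, `-u'' + V u = z u`, `u(0) = c₀`, `u'(0) = c₁`. -/
def IsSolution (l : ℝ) (V : ℝ → ℝ) (z c₀ c₁ : ℂ) (u : ℝ → ℂ) : Prop :=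
  MemH2 l u ∧ (∀ᵐ t ∂(edgeMeasure l), schrodinger l V u t = z * u t) ∧
    u 0 = c₀ ∧ edgeDeriv l u 0 = c₁

open Classical in
/-- The solution of this initial value problem, which exists and is unique on `[0, l]` for
`V ∈ L²[0, l]`. -/
def solution (l : ℝ) (V : ℝ → ℝ) (z c₀ c₁ : ℂ) : ℝ → ℂ :=
  if h : ∃ u, IsSolution l V z c₀ c₁ u then h.choose else 0

/-- The solution `u₁` with `u₁(0; z) = 0`, `u₁'(0; z) = 1`. -/
def u₁ (l : ℝ) (V : ℝ → ℝ) (z : ℂ) : ℝ → ℂ := solution l V z 0 1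

/-- The solution `u₂` with `u₂(0; z) = 1`, `u₂'(0; z) = 0`. -/
def u₂ (l : ℝ) (V : ℝ → ℝ) (z : ℂ) : ℝ → ℂ := solution l V z 1 0

/-- The Krein matrix `s(z)`, which takes `(f(0), f(l))` to `(f'(0), -f'(l))` for the solutions of
`-f'' + V f = z f`. -/
def kreinMatrix (l : ℝ) (V : ℝ → ℝ) (z : ℂ) : Matrix (Fin 2) (Fin 2) ℂ :=
  (1 / u₁ l V z l) • !![-u₂ l V z l, 1; 1, -edgeDeriv l (u₁ l V z) l]

/-! ### The discrete magnetic Laplacian -/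

/-- `ℓ²(ℤ²)`. -/
abbrev L2Z2 : Type := lp (fun _ : ℤ × ℤ => ℂ) 2

/-- The operator `(W g)(p) = exp(i c(p)) g(e p)` on `ℓ²(ℤ²)`. -/
def magneticShift (e : ℤ × ℤ ≃ ℤ × ℤ) (c : ℤ × ℤ → ℝ) : L2Z2 →L[ℂ] L2Z2 :=
  have key : ∀ (g : L2Z2) (p : ℤ × ℤ),
      ‖Complex.exp (Complex.I * c p) * g (e p)‖ ^ (2 : ENNReal).toReal
        = ‖g (e p)‖ ^ (2 : ENNReal).toReal := fun g p => by
    rw [norm_mul, mul_comm Complex.I, Complex.norm_exp_ofReal_mul_I, one_mul]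
  have hpos : 0 < (2 : ENNReal).toReal := by norm_num
  LinearMap.mkContinuous
    { toFun := fun g => ⟨fun p => Complex.exp (Complex.I * c p) * g (e p), by
        refine memℓp_gen ?_
        simp only [key]
        exact e.summable_iff.mpr ((lp.memℓp g).summable hpos)⟩
      map_add' := fun g h => lp.ext (funext fun p => mul_add _ _ _)
      map_smul' := fun a g => lp.ext (funext fun p => mul_left_comm _ _ _) }
    1 (fun g => by
      rw [one_mul, lp.norm_eq_tsum_rpow hpos, lp.norm_eq_tsum_rpow hpos]
      refine le_of_eq (congrArg (fun x : ℝ => x ^ (1 / (2 : ENNReal).toReal)) ?_)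
      refine (tsum_congr fun p => key g p).trans ?_
      exact e.tsum_eq (fun q => ‖g q‖ ^ (2 : ENNReal).toReal))

theorem magneticShift_apply (e : ℤ × ℤ ≃ ℤ × ℤ) (c : ℤ × ℤ → ℝ) (g : L2Z2) (p : ℤ × ℤ) :
    magneticShift e c g p = Complex.exp (Complex.I * c p) * g (e p) := rfl

/-- The discrete magnetic Laplacian `M(θ, β)`, a bounded operator on `ℓ²(ℤ²)`. -/
def discreteMagneticLaplacian (θ β : ℝ) : L2Z2 →L[ℂ] L2Z2 :=
  magneticShift (Equiv.addRight (1, 0)) (fun p => Real.pi * p.2 * θ)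
    + magneticShift (Equiv.addRight (-1, 0)) (fun p => -(Real.pi * p.2 * θ))
    + (β ^ 2 : ℂ) • (magneticShift (Equiv.addRight (0, 1)) (fun p => -(Real.pi * p.1 * θ))
      + magneticShift (Equiv.addRight (0, -1)) (fun p => Real.pi * p.1 * θ))

theorem discreteMagneticLaplacian_apply (θ β : ℝ) (g : L2Z2) (m n : ℤ) :
    discreteMagneticLaplacian θ β g (m, n)
      = Complex.exp (Complex.I * Real.pi * n * θ) * g (m + 1, n)
        + Complex.exp (-(Complex.I * Real.pi * n * θ)) * g (m - 1, n)
        + β ^ 2 * (Complex.exp (-(Complex.I * Real.pi * m * θ)) * g (m, n + 1)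
          + Complex.exp (Complex.I * Real.pi * m * θ) * g (m, n - 1)) := by
  have h : discreteMagneticLaplacian θ β g (m, n)
      = magneticShift (Equiv.addRight (1, 0)) (fun p => Real.pi * p.2 * θ) g (m, n)
    + magneticShift (Equiv.addRight (-1, 0)) (fun p => -(Real.pi * p.2 * θ)) g (m, n)
    + (β ^ 2 : ℂ) * (magneticShift (Equiv.addRight (0, 1)) (fun p => -(Real.pi * p.1 * θ)) g (m, n)
      + magneticShift (Equiv.addRight (0, -1)) (fun p => Real.pi * p.1 * θ) g (m, n)) := rfl
  rw [h]
  simp only [magneticShift_apply, Equiv.coe_addRight, Prod.mk_add_mk, add_zero, ← sub_eq_add_neg]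
  push_cast
  simp only [mul_neg, mul_assoc]

end QuantumGraph

end

/-! A unimodular gauge transformation turns every edge operator into the Schrödinger operator
`-d²/dt² + V` without magnetic potential and puts the flux into phase factors at the end points of
the edges. On a single edge, `-f'' + V f = z f + h` is solved by the Dirichlet resolvent plus a
combination of the two homogeneous solutions with boundary values `(1, 0)` and `(0, 1)`, whose
derivatives at the end points form the Krein matrix `s(z)`. Hence, after the gauge transformation,
the solutions of `(L - z) f = h` are the functions `f = R₀ h + γ g` with `N g + τ h = 0`: here `R₀`
is the Dirichlet resolvent on all edges, `γ` extends the node values `g` to the edges by homogeneous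
solutions, `τ h` is the flux of `R₀ h` at the nodes, and `N` is the discrete magnetic operator of
the theorem. Since `γ` is injective and `τ` is surjective, the resolvent of `L` at `z` exists if and
only if `N` is invertible, and it is then given by Krein's formula `R₀ - γ N⁻¹ τ`. -/

noncomputable section

namespace QuantumGraph

/-! ### Sobolev functions -/

section AbsolutelyContinuous

variable {E : Type*} {a b : ℝ}

theorem absolutelyContinuousOnInterval_congr [PseudoMetricSpace E] {f g : ℝ → E}
    (hf : AbsolutelyContinuousOnInterval f a b) (h : EqOn g f (uIcc a b)) :
    AbsolutelyContinuousOnInterval g a b := by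
  rw [absolutelyContinuousOnInterval_iff] at hf ⊢
  intro ε hε
  obtain ⟨δ, hδ, H⟩ := hf ε hε
  refine ⟨δ, hδ, fun I hI hI' => ?_⟩
  convert H I hI hI' using 1
  refine Finset.sum_congr rfl fun i hi => ?_
  rw [h (hI.1 i hi).1, h (hI.1 i hi).2]

variable [NormedAddCommGroup E] [NormedSpace ℝ E]

-- The increments of `∫ v` are dominated by those of the real function `∫ ‖v‖`.
theorem absolutelyContinuousOnInterval_primitive {v : ℝ → E}
    (hv : IntervalIntegrable v volume a b) :
    AbsolutelyContinuousOnInterval (fun t => ∫ s in a..t, v s) a b := by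
  have hnorm := hv.norm.absolutelyContinuousOnInterval_intervalIntegral (c := a) left_mem_uIcc
  rw [absolutelyContinuousOnInterval_iff] at hnorm ⊢
  intro ε hε
  obtain ⟨δ, hδ, H⟩ := hnorm ε hε
  refine ⟨δ, hδ, fun I hI hI' => lt_of_le_of_lt (Finset.sum_le_sum fun i hi => ?_) (H I hI hI')⟩
  have hx := (hI.1 i hi).1
  have hy := (hI.1 i hi).2
  have hsub : ∀ x ∈ uIcc a b, IntervalIntegrable v volume a x := fun x hx =>
    hv.mono_set (uIcc_subset_uIcc left_mem_uIcc hx)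
  rw [dist_eq_norm, dist_eq_norm,
    intervalIntegral.integral_interval_sub_left (hsub _ hx) (hsub _ hy),
    intervalIntegral.integral_interval_sub_left (hsub _ hx).norm (hsub _ hy).norm,
    Real.norm_eq_abs]
  exact intervalIntegral.norm_integral_le_abs_integral_norm

theorem eq_add_integral_of_ae_hasDerivAt [CompleteSpace E] {u v : ℝ → E}
    (hu : AbsolutelyContinuousOnInterval u a b) (hv : IntervalIntegrable v volume a b)
    (h : ∀ᵐ t, t ∈ uIcc a b → HasDerivAt u (v t) t) {t : ℝ} (ht : t ∈ uIcc a b) :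
    u t = u a + ∫ s in a..t, v s := by
  obtain ⟨C, hC⟩ := (hu.sub (absolutelyContinuousOnInterval_primitive hv)
    ).const_of_ae_hasDerivAt_zero (by
      filter_upwards [h, hv.ae_hasDerivAt_integral] with t hut hvt ht
      simpa using (hut ht).sub (hvt ht a left_mem_uIcc))
  have hCt := hC t ht
  have hCa := hC a left_mem_uIcc
  simp only [Pi.sub_apply, intervalIntegral.integral_same, sub_zero] at hCt hCa
  rw [hCa, ← hCt, sub_add_cancel]

end AbsolutelyContinuous

section EdgeMeasure

variable {l : ℝ} {E : Type*} [NormedAddCommGroup E]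

theorem ae_edgeMeasure_iff (p : ℝ → Prop) :
    (∀ᵐ t ∂(edgeMeasure l), p t) ↔ ∀ᵐ t, t ∈ Icc 0 l → p t :=
  ae_restrict_iff' measurableSet_Icc

theorem ae_mem_Ioo (l : ℝ) : ∀ᵐ t ∂(edgeMeasure l), t ∈ Ioo 0 l := by
  rw [edgeMeasure, ← Measure.restrict_congr_set Ioo_ae_eq_Icc]
  exact ae_restrict_mem measurableSet_Ioo

theorem intervalIntegrable_of_memLp_edgeMeasure (hl : 0 ≤ l) {v : ℝ → E}
    (hv : MemLp v 2 (edgeMeasure l)) : IntervalIntegrable v volume 0 l := by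
  rw [intervalIntegrable_iff_integrableOn_Icc_of_le hl]
  exact hv.integrable one_le_two

theorem memLp_edgeMeasure_of_continuousOn {v : ℝ → E} (hv : ContinuousOn v (Icc 0 l)) :
    MemLp v 2 (edgeMeasure l) := by
  obtain ⟨C, hC⟩ := isCompact_Icc.exists_bound_of_continuousOn hv
  refine MemLp.of_bound (hv.aestronglyMeasurable measurableSet_Icc) C ?_
  filter_upwards [ae_mem_edge l] with t ht using hC t ht

theorem memLp_continuousOn_mul {f g : ℝ → ℂ} (hf : ContinuousOn f (Icc 0 l))
    (hg : MemLp g 2 (edgeMeasure l)) : MemLp (fun t => f t * g t) 2 (edgeMeasure l) := by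
  obtain ⟨C, hC⟩ := isCompact_Icc.exists_bound_of_continuousOn hf
  refine MemLp.of_le_mul (c := C) hg
    ((hf.aestronglyMeasurable measurableSet_Icc).mul hg.1) ?_
  filter_upwards [ae_mem_edge l] with t ht
  rw [norm_mul]
  exact mul_le_mul_of_nonneg_right (hC t ht) (norm_nonneg _)

end EdgeMeasure

section MemH1

variable {l : ℝ} {E : Type*} [NormedAddCommGroup E] [NormedSpace ℝ E]

theorem MemH1.neg {u : ℝ → E} (hu : MemH1 l u) : MemH1 l (-u) := by
  obtain ⟨v, hv, huv⟩ := hu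
  refine ⟨-v, hv.neg, fun t ht => ?_⟩
  simp only [Pi.neg_apply, huv t ht, intervalIntegral.integral_neg, neg_add]

theorem edgeDeriv_eq_of_hasDerivWithinAt (hl : 0 < l) {u : ℝ → E} {u' : E} {t : ℝ}
    (ht : t ∈ Icc 0 l) (h : HasDerivWithinAt u u' (Icc 0 l) t) : edgeDeriv l u t = u' :=
  h.derivWithin (uniqueDiffOn_Icc hl t ht)

theorem MemH1.absolutelyContinuousOnInterval (hl : 0 ≤ l) {u : ℝ → E} (hu : MemH1 l u) :
    AbsolutelyContinuousOnInterval u 0 l := by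
  obtain ⟨v, hv, h⟩ := hu
  have hprim := absolutelyContinuousOnInterval_primitive
    (intervalIntegrable_of_memLp_edgeMeasure hl hv)
  have hconst : AbsolutelyContinuousOnInterval (fun _ : ℝ => u 0) 0 l :=
    contDiff_const.contDiffOn.absolutelyContinuousOnInterval
  exact absolutelyContinuousOnInterval_congr (hconst.add hprim) fun t ht =>
    h t (uIcc_of_le hl ▸ ht)

theorem MemH1.continuousOn (hl : 0 ≤ l) {u : ℝ → E} (hu : MemH1 l u) :
    ContinuousOn u (Icc 0 l) := by
  simpa only [uIcc_of_le hl] using (hu.absolutelyContinuousOnInterval hl).continuousOn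

variable [CompleteSpace E]

theorem memH1_of_ae_hasDerivAt (hl : 0 ≤ l) {u v : ℝ → E}
    (hu : AbsolutelyContinuousOnInterval u 0 l) (hv : MemLp v 2 (edgeMeasure l))
    (h : ∀ᵐ t ∂(edgeMeasure l), HasDerivAt u (v t) t) : MemH1 l u := by
  rw [ae_edgeMeasure_iff, ← uIcc_of_le hl] at h
  exact ⟨v, hv, fun t ht => eq_add_integral_of_ae_hasDerivAt hu
    (intervalIntegrable_of_memLp_edgeMeasure hl hv) h (uIcc_of_le hl ▸ ht)⟩

theorem MemH1.ae_hasDerivAt {u : ℝ → E} (hu : MemH1 l u) :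
    ∀ᵐ t ∂(edgeMeasure l), HasDerivAt u (edgeDeriv l u t) t := by
  filter_upwards [hu.ae_differentiable, ae_mem_Ioo l] with t hd ht
  exact hd.hasDerivWithinAt.hasDerivAt (Icc_mem_nhds ht.1 ht.2)

theorem MemH1.memLp_edgeDeriv (hl : 0 ≤ l) {u : ℝ → E} (hu : MemH1 l u) :
    MemLp (edgeDeriv l u) 2 (edgeMeasure l) := by
  obtain ⟨v, hv, h⟩ := id hu
  have hderiv := (intervalIntegrable_of_memLp_edgeMeasure hl hv).ae_hasDerivAt_integral
  rw [uIcc_of_le hl, ← ae_edgeMeasure_iff] at hderiv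
  refine hv.ae_eq ?_
  filter_upwards [hu.ae_hasDerivAt, hderiv, ae_mem_Ioo l] with t hut hvt ht
  refine (((hvt 0 ⟨le_rfl, hl⟩).const_add (u 0)).congr_of_eventuallyEq ?_).unique hut
  filter_upwards [Icc_mem_nhds ht.1 ht.2] with s hs using h s hs

theorem MemH1.eq_add_integral (hl : 0 ≤ l) {u : ℝ → E} (hu : MemH1 l u) {t : ℝ}
    (ht : t ∈ Icc 0 l) : u t = u 0 + ∫ s in (0 : ℝ)..t, edgeDeriv l u s := by
  have hderiv := hu.ae_hasDerivAt
  rw [ae_edgeMeasure_iff, ← uIcc_of_le hl] at hderiv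
  exact eq_add_integral_of_ae_hasDerivAt (hu.absolutelyContinuousOnInterval hl)
    (intervalIntegrable_of_memLp_edgeMeasure hl (hu.memLp_edgeDeriv hl)) hderiv
    (uIcc_of_le hl ▸ ht)

theorem memH1_of_hasDerivWithinAt {u u' : ℝ → E}
    (h : ∀ t ∈ Icc 0 l, HasDerivWithinAt u (u' t) (Icc 0 l) t) (hc : ContinuousOn u' (Icc 0 l)) :
    MemH1 l u := by
  refine ⟨u', memLp_edgeMeasure_of_continuousOn hc, fun t ht => ?_⟩
  have hsub : Icc 0 t ⊆ Icc 0 l := Icc_subset_Icc_right ht.2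
  rw [intervalIntegral.integral_eq_sub_of_hasDerivAt_of_le ht.1
    (fun s hs => (h s (hsub hs)).continuousWithinAt.mono hsub) (fun s hs => (h s
      (hsub (Ioo_subset_Icc_self hs))).hasDerivAt (Icc_mem_nhds hs.1 (hs.2.trans_le ht.2)))
    ((hc.mono hsub).intervalIntegrable_of_Icc ht.1), add_sub_cancel]

theorem MemH1.mul (hl : 0 ≤ l) {f g : ℝ → ℂ} (hf : MemH1 l f) (hg : MemH1 l g) :
    MemH1 l (fun t => f t * g t) := by
  refine memH1_of_ae_hasDerivAt hl (v := fun t => g t * edgeDeriv l f t + f t * edgeDeriv l g t)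
    ((hf.absolutelyContinuousOnInterval hl).smul (hg.absolutelyContinuousOnInterval hl))
    ((memLp_continuousOn_mul (hg.continuousOn hl) (hf.memLp_edgeDeriv hl)).add
      (memLp_continuousOn_mul (hf.continuousOn hl) (hg.memLp_edgeDeriv hl))) ?_
  filter_upwards [hf.ae_hasDerivAt, hg.ae_hasDerivAt] with t hft hgt
  exact (hft.mul hgt).congr_deriv (by ring)

theorem MemH1.ofReal {f : ℝ → ℝ} (hf : MemH1 l f) : MemH1 l (fun t => (f t : ℂ)) := by
  obtain ⟨v, hv, h⟩ := hf
  refine ⟨fun t => (v t : ℂ), hv.ofReal, fun t ht => ?_⟩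
  simp only [h t ht, intervalIntegral.integral_ofReal, Complex.ofReal_add]

end MemH1

section MemH2

variable {l : ℝ} {V : ℝ → ℝ} {u w : ℝ → ℂ}

theorem MemH2.hasDerivWithinAt (hu : MemH2 l u) {t : ℝ} (ht : t ∈ Icc 0 l) :
    HasDerivWithinAt u (edgeDeriv l u t) (Icc 0 l) t :=
  (hu.1 t ht).hasDerivWithinAt

theorem MemH2.memH1 (hl : 0 ≤ l) (hu : MemH2 l u) : MemH1 l u :=
  memH1_of_hasDerivWithinAt (fun _ ht => hu.hasDerivWithinAt ht) (hu.2.continuousOn hl)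

theorem MemH2.memLp (hu : MemH2 l u) : MemLp u 2 (edgeMeasure l) :=
  memLp_edgeMeasure_of_continuousOn hu.1.continuousOn

theorem memH2_of_hasDerivWithinAt (hl : 0 < l) {u' : ℝ → ℂ}
    (h : ∀ t ∈ Icc 0 l, HasDerivWithinAt u (u' t) (Icc 0 l) t) (h' : MemH1 l u') : MemH2 l u :=
  ⟨fun t ht => (h t ht).differentiableWithinAt,
    h'.congr fun _ ht => edgeDeriv_eq_of_hasDerivWithinAt hl ht (h _ ht)⟩

theorem memH2_of_contDiff (hl : 0 < l) (hu : ContDiff ℝ 2 u) : MemH2 l u := by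
  have hu' : ContDiff ℝ 1 (deriv u) := ((contDiff_succ_iff_deriv (n := 1)).1 hu).2.2
  have hu'' := contDiff_one_iff_deriv.1 hu'
  exact memH2_of_hasDerivWithinAt hl
    (fun t _ => (hu.differentiable two_ne_zero t).hasDerivAt.hasDerivWithinAt)
    (memH1_of_hasDerivWithinAt (fun t _ => (hu''.1 t).hasDerivAt.hasDerivWithinAt)
      hu''.2.continuousOn)

theorem MemH2.memLp_schrodinger (hl : 0 ≤ l) (hV : MemLp V 2 (edgeMeasure l)) (hu : MemH2 l u) :
    MemLp (schrodinger l V u) 2 (edgeMeasure l) := by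
  have hVu := memLp_continuousOn_mul hu.1.continuousOn (hV.ofReal (K := ℂ))
  simp only [mul_comm (u _)] at hVu
  exact (hu.2.memLp_edgeDeriv hl).neg.add hVu

-- The Wronskian `u w' - u' w` is absolutely continuous, with derivative `w'' u - u'' w`.
theorem integral_schrodinger_mul_sub (hl : 0 ≤ l) (hu : MemH2 l u) (hw : MemH2 l w) :
    ∫ t in (0 : ℝ)..l, (schrodinger l V u t * w t - u t * schrodinger l V w t)
      = (u l * edgeDeriv l w l - edgeDeriv l u l * w l)
        - (u 0 * edgeDeriv l w 0 - edgeDeriv l u 0 * w 0) := by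
  have hu₁ := hu.memH1 hl
  have hw₁ := hw.memH1 hl
  have hWronskian : AbsolutelyContinuousOnInterval
      (fun t => u t * edgeDeriv l w t - edgeDeriv l u t * w t) 0 l :=
    ((hu₁.absolutelyContinuousOnInterval hl).smul
        (hw.2.absolutelyContinuousOnInterval hl)).sub
      ((hu.2.absolutelyContinuousOnInterval hl).smul
        (hw₁.absolutelyContinuousOnInterval hl))
  have hint : IntervalIntegrable (fun t => u t * edgeDeriv l (edgeDeriv l w) t
      - w t * edgeDeriv l (edgeDeriv l u) t) volume 0 l :=
    intervalIntegrable_of_memLp_edgeMeasure hl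
      ((memLp_continuousOn_mul hu.1.continuousOn (hw.2.memLp_edgeDeriv hl)).sub
        (memLp_continuousOn_mul hw.1.continuousOn (hu.2.memLp_edgeDeriv hl)))
  have hderiv : ∀ᵐ t, t ∈ uIcc 0 l → HasDerivAt
      (fun t => u t * edgeDeriv l w t - edgeDeriv l u t * w t)
      (u t * edgeDeriv l (edgeDeriv l w) t - w t * edgeDeriv l (edgeDeriv l u) t) t := by
    rw [uIcc_of_le hl, ← ae_edgeMeasure_iff]
    filter_upwards [hu₁.ae_hasDerivAt, hw₁.ae_hasDerivAt, hu.2.ae_hasDerivAt, hw.2.ae_hasDerivAt]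
      with t hut hwt hut' hwt'
    exact ((hut.mul hwt').sub (hut'.mul hwt)).congr_deriv (by ring)
  rw [eq_add_integral_of_ae_hasDerivAt hWronskian hint hderiv right_mem_uIcc,
    add_sub_cancel_left]
  refine intervalIntegral.integral_congr fun t _ => ?_
  simp only [schrodinger]
  ring

end MemH2

/-! ### Gauging away the magnetic potential of an edge -/

section Gauge

variable {l : ℝ} {A P V : ℝ → ℝ} {φ : ℝ → ℂ}

/-- Multiplication of a function by the phase factor `exp (i P)`: the gauge transformation which
takes the potential `0` to the potential `P'`. -/
def phaseMul (P : ℝ → ℝ) (φ : ℝ → ℂ) : ℝ → ℂ := fun t => Complex.exp (Complex.I * P t) * φ t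

theorem phaseMul_phaseMul_neg (P : ℝ → ℝ) (φ : ℝ → ℂ) : phaseMul P (phaseMul (-P) φ) = φ := by
  funext t
  simp [phaseMul, ← mul_assoc, ← Complex.exp_add]

theorem norm_phaseMul (P : ℝ → ℝ) (φ : ℝ → ℂ) (t : ℝ) : ‖phaseMul P φ t‖ = ‖φ t‖ := by
  rw [phaseMul, norm_mul, mul_comm, Complex.norm_exp_I_mul_ofReal, mul_one]

theorem hasDerivAt_phase {a t : ℝ} (hP : HasDerivAt P a t) :
    HasDerivAt (fun s => Complex.exp (Complex.I * P s))
      (Complex.exp (Complex.I * P t) * (Complex.I * a)) t :=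
  (hP.ofReal_comp.const_mul Complex.I).cexp

theorem hasDerivWithinAt_phaseMul {s : Set ℝ} {a t : ℝ} (hP : HasDerivAt P a t) {φ' : ℂ}
    (hφ : HasDerivWithinAt φ φ' s t) :
    HasDerivWithinAt (phaseMul P φ)
      (Complex.exp (Complex.I * P t) * (φ' + Complex.I * a * φ t)) s t :=
  ((hasDerivAt_phase hP).hasDerivWithinAt.mul hφ).congr_deriv (by ring)

theorem edgeDeriv_phaseMul (hl : 0 < l) {a t : ℝ} (hP : HasDerivAt P a t) (ht : t ∈ Icc 0 l)
    (hφ : DifferentiableWithinAt ℝ φ (Icc 0 l) t) : edgeDeriv l (phaseMul P φ) t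
      = Complex.exp (Complex.I * P t) * (edgeDeriv l φ t + Complex.I * a * φ t) :=
  edgeDeriv_eq_of_hasDerivWithinAt hl ht (hasDerivWithinAt_phaseMul hP hφ.hasDerivWithinAt)

theorem MemH2.phaseMul (hl : 0 < l) (hP : ∀ t, HasDerivAt P (A t) t) (hA : MemH1 l A)
    (hφ : MemH2 l φ) : MemH2 l (phaseMul P φ) := by
  have hIA : MemH1 l (fun t => Complex.I * (A t : ℂ)) := hA.ofReal.smul Complex.I
  have hexp : MemH1 l (fun t => Complex.exp (Complex.I * P t)) := by
    have hcont : Continuous (fun t => Complex.exp (Complex.I * P t)) :=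
      continuous_iff_continuousAt.2 fun t => (hasDerivAt_phase (hP t)).continuousAt
    exact memH1_of_hasDerivWithinAt (fun t _ => (hasDerivAt_phase (hP t)).hasDerivWithinAt)
      (hcont.continuousOn.mul (hIA.continuousOn hl.le))
  exact memH2_of_hasDerivWithinAt hl
    (fun t ht => hasDerivWithinAt_phaseMul (hP t) (hφ.hasDerivWithinAt ht))
    (hexp.mul hl.le (hφ.2.add (hIA.mul hl.le (hφ.memH1 hl.le))))

theorem covDeriv_phaseMul (hl : 0 < l) {t : ℝ} (hP : HasDerivAt P (A t) t) (hφ : MemH2 l φ)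
    (ht : t ∈ Icc 0 l) :
    covDeriv l A (phaseMul P φ) t = phaseMul P (edgeDeriv l φ) t := by
  rw [covDeriv, edgeDeriv_phaseMul hl hP ht (hφ.1 t ht), QuantumGraph.phaseMul,
    QuantumGraph.phaseMul]
  ring

theorem momentum_phaseMul (hl : 0 < l) {t : ℝ} (hP : HasDerivAt P (A t) t) (ht : t ∈ Icc 0 l)
    (hφ : DifferentiableWithinAt ℝ φ (Icc 0 l) t) :
    momentum l A (phaseMul P φ) t = phaseMul P (-Complex.I • edgeDeriv l φ) t := by
  rw [momentum, edgeDeriv_phaseMul hl hP ht hφ]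
  simp only [phaseMul, Pi.smul_apply, smul_eq_mul]
  linear_combination (-A t * φ t * Complex.exp (Complex.I * P t)) * Complex.I_mul_I

theorem magneticSchrodinger_phaseMul (hl : 0 < l) (hP : ∀ t, HasDerivAt P (A t) t)
    (hφ : MemH2 l φ) : magneticSchrodinger l A V (phaseMul P φ)
      =ᵐ[edgeMeasure l] phaseMul P (schrodinger l V φ) := by
  have hmomentum : EqOn (momentum l A (phaseMul P φ))
      (phaseMul P (-Complex.I • edgeDeriv l φ)) (Icc 0 l) := fun t ht =>
    momentum_phaseMul hl (hP t) ht (hφ.1 t ht)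
  filter_upwards [hφ.2.ae_differentiable, ae_mem_edge l] with t hφ'' ht
  have hderiv : edgeDeriv l (-Complex.I • edgeDeriv l φ) t
      = -Complex.I • edgeDeriv l (edgeDeriv l φ) t := derivWithin_const_smul _ hφ''
  rw [magneticSchrodinger, momentum_congr hmomentum ht,
    momentum_phaseMul hl (hP t) ht (hφ''.const_smul _)]
  simp only [phaseMul, schrodinger, Pi.smul_apply, hderiv, smul_eq_mul]
  linear_combination (Complex.exp (Complex.I * P t) * edgeDeriv l (edgeDeriv l φ) t)
    * Complex.I_mul_I

end Gauge

/-! ### Resolvents and the Krein formula -/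

section Resolvent

variable {H : Type*} [NormedAddCommGroup H] [NormedSpace ℂ H] {T : H →ₗ.[ℂ] H} {z : ℂ}

theorem mem_resolventSet_iff :
    z ∈ resolventSet T ↔ ∃ R : H →L[ℂ] H, ∀ h f, R h = f ↔ (f, h + z • f) ∈ T.graph := by
  constructor
  · rintro ⟨R, hleft, hright⟩
    refine ⟨R, fun h f => ⟨?_, fun hf => ?_⟩⟩
    · rintro rfl
      obtain ⟨hdom, hR⟩ := hright h
      rw [← sub_eq_iff_eq_add.1 hR]
      exact T.mem_graph ⟨R h, hdom⟩
    · obtain ⟨x, rfl, hTx⟩ := T.mem_graph_iff.1 hf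
      simpa only [hTx, add_sub_cancel_right] using hleft x
  · rintro ⟨R, hR⟩
    refine ⟨R, fun x => ?_, fun y => ?_⟩
    · rw [hR, sub_add_cancel]
      exact T.mem_graph x
    · obtain ⟨x, hx, hTx⟩ := T.mem_graph_iff.1 ((hR y _).1 rfl)
      have hdom : R y ∈ T.domain := by
        rw [← show (x : H) = R y from hx]
        exact x.2
      refine ⟨hdom, ?_⟩
      rw [show (⟨R y, hdom⟩ : T.domain) = x from Subtype.ext hx.symm, hTx, add_sub_cancel_right]

/-- The resolvent `(T - z)⁻¹`. -/
def resolventOperator (hz : z ∈ resolventSet T) : H →L[ℂ] H :=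
  (mem_resolventSet_iff.1 hz).choose

theorem resolventOperator_eq_iff (hz : z ∈ resolventSet T) {h f : H} :
    resolventOperator hz h = f ↔ (f, h + z • f) ∈ T.graph :=
  (mem_resolventSet_iff.1 hz).choose_spec h f

-- Krein's formula: when `N` is invertible, the resolvent is `R₀ - γ N⁻¹ τ`.
theorem mem_resolventSet_iff_isUnit {K : Type*} [NormedAddCommGroup K] [NormedSpace ℂ K]
    [CompleteSpace K] (R₀ : H →L[ℂ] H) (γ : K →L[ℂ] H) (τ : H →L[ℂ] K) (N : K →L[ℂ] K)
    (hγ : Function.Injective γ) (hτ : Function.Surjective τ)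
    (hT : ∀ f h, (f, h + z • f) ∈ T.graph ↔ ∃ g, f = R₀ h + γ g ∧ N g + τ h = 0) :
    z ∈ resolventSet T ↔ IsUnit N := by
  rw [mem_resolventSet_iff]
  constructor
  · rintro ⟨R, hR⟩
    refine ContinuousLinearMap.isUnit_iff_bijective.2
      ⟨(injective_iff_map_eq_zero N).2 fun g hg => ?_, fun y => ?_⟩
    · have hRγ : R 0 = γ g := (hR _ _).2 ((hT _ _).2 ⟨g, by simp, by simp [hg]⟩)
      exact hγ (by rw [← hRγ, map_zero, map_zero])
    · obtain ⟨h, hh⟩ := hτ (-y)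
      obtain ⟨g, -, hg⟩ := (hT _ _).1 ((hR h _).1 rfl)
      exact ⟨g, by rw [eq_neg_of_add_eq_zero_left hg, hh, neg_neg]⟩
  · rintro ⟨N, rfl⟩
    let N' : K ≃L[ℂ] K := ContinuousLinearEquiv.ofUnit N
    refine ⟨R₀ - γ ∘L N'.symm ∘L τ, fun h f => ?_⟩
    have hRh : (R₀ - γ ∘L N'.symm ∘L τ) h = R₀ h + γ (-N'.symm (τ h)) := by
      rw [map_neg, ← sub_eq_add_neg]
      rfl
    rw [hT, hRh]
    constructor
    · rintro rfl
      exact ⟨_, rfl, by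
        rw [map_neg, neg_add_eq_zero]
        exact N'.apply_symm_apply (τ h)⟩
    · rintro ⟨g, rfl, hg⟩
      have hsymm : -N'.symm (τ h) = g := by
        rw [neg_eq_iff_eq_neg, N'.symm_apply_eq, map_neg]
        exact eq_neg_of_add_eq_zero_right hg
      rw [hsymm]

theorem mem_resolventSet_iff_isUnit_of_conj {K : Type*} [NormedAddCommGroup K] [NormedSpace ℂ K]
    [CompleteSpace K] (U : H ≃L[ℂ] H) (R₀ : H →L[ℂ] H) (γ : K →L[ℂ] H) (τ : H →L[ℂ] K)
    (N : K →L[ℂ] K) (hγ : Function.Injective γ) (hτ : Function.Surjective τ)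
    (hT : ∀ f h, (U f, U (h + z • f)) ∈ T.graph ↔ ∃ g, f = R₀ h + γ g ∧ N g + τ h = 0) :
    z ∈ resolventSet T ↔ IsUnit N := by
  refine mem_resolventSet_iff_isUnit ((U : H →L[ℂ] H) ∘L R₀ ∘L (U.symm : H →L[ℂ] H))
    ((U : H →L[ℂ] H) ∘L γ) (τ ∘L (U.symm : H →L[ℂ] H)) N (U.injective.comp hγ)
    (hτ.comp U.symm.surjective) fun f h => ?_
  obtain ⟨f, rfl⟩ := U.surjective f
  obtain ⟨h, rfl⟩ := U.surjective h
  rw [← map_smul, ← map_add, hT]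
  refine exists_congr fun g => and_congr ?_ ?_
  · simp only [ContinuousLinearMap.comp_apply, ContinuousLinearEquiv.coe_coe,
      U.symm_apply_apply, ← map_add, U.injective.eq_iff]
  · simp only [ContinuousLinearMap.comp_apply, ContinuousLinearEquiv.coe_coe, U.symm_apply_apply]

end Resolvent

/-! ### The Schrödinger equation on an edge -/

/-- `φ ∈ H²[0, l]` solves the inhomogeneous equation `-φ'' + V φ - z φ = h` on the edge. -/
def IsEdgeSolution (l : ℝ) (V : ℝ → ℝ) (z : ℂ) (h φ : ℝ → ℂ) : Prop :=
  MemH2 l φ ∧ ∀ᵐ t ∂(edgeMeasure l), schrodinger l V φ t = h t + z * φ t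

namespace IsEdgeSolution

variable {l : ℝ} {V : ℝ → ℝ} {z : ℂ} {h k φ ψ : ℝ → ℂ}

theorem add (hφ : IsEdgeSolution l V z h φ) (hψ : IsEdgeSolution l V z k ψ) :
    IsEdgeSolution l V z (h + k) (φ + ψ) := by
  refine ⟨hφ.1.add hψ.1, ?_⟩
  filter_upwards [schrodinger_add (V := V) hφ.1 hψ.1, hφ.2, hψ.2] with t hadd hφt hψt
  rw [hadd, Pi.add_apply, hφt, hψt, Pi.add_apply, Pi.add_apply]
  ring

theorem smul (hφ : IsEdgeSolution l V z h φ) (c : ℂ) :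
    IsEdgeSolution l V z (c • h) (c • φ) := by
  refine ⟨hφ.1.smul c, ?_⟩
  filter_upwards [schrodinger_smul (V := V) hφ.1 c, hφ.2] with t hsmul hφt
  rw [hsmul, Pi.smul_apply, hφt, Pi.smul_apply, Pi.smul_apply, smul_eq_mul, smul_eq_mul,
    smul_eq_mul]
  ring

theorem congr (hφ : IsEdgeSolution l V z h φ) (hk : h =ᵐ[edgeMeasure l] k) :
    IsEdgeSolution l V z k φ :=
  ⟨hφ.1, by filter_upwards [hφ.2, hk] with t hφt hkt; rw [hφt, hkt]⟩

theorem green (hl : 0 ≤ l) (hφ : IsEdgeSolution l V z h φ) (hψ : IsEdgeSolution l V z k ψ) :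
    ∫ t, (h t * ψ t - φ t * k t) ∂(edgeMeasure l)
      = (φ l * edgeDeriv l ψ l - edgeDeriv l φ l * ψ l)
        - (φ 0 * edgeDeriv l ψ 0 - edgeDeriv l φ 0 * ψ 0) := by
  rw [← integral_schrodinger_mul_sub (V := V) hl hφ.1 hψ.1, intervalIntegral.integral_of_le hl,
    ← integral_Icc_eq_integral_Ioc]
  refine integral_congr_ae ?_
  filter_upwards [hφ.2, hψ.2] with t hφt hψt
  rw [hφt, hψt]
  ring

end IsEdgeSolution

section InitialValues

variable {a b : ℝ} {q y : ℝ → ℝ}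

theorem integral_mul_primitive_pow (hq : IntervalIntegrable q volume a b) (n : ℕ) {t : ℝ}
    (ht : t ∈ uIcc a b) :
    ∫ s in a..t, q s * (∫ r in a..s, q r) ^ n = (∫ r in a..t, q r) ^ (n + 1) / (n + 1) := by
  set Q : ℝ → ℝ := fun t => ∫ r in a..t, q r
  have hQ : AbsolutelyContinuousOnInterval Q a b := absolutelyContinuousOnInterval_primitive hq
  have hpow : ∀ k : ℕ, AbsolutelyContinuousOnInterval (fun t => Q t ^ k) a b := fun k => by
    induction k with
    | zero =>
      simpa only [pow_zero] using
        (contDiff_const (c := (1 : ℝ))).contDiffOn.absolutelyContinuousOnInterval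
    | succ k ih =>
      simp only [pow_succ]
      exact ih.mul hQ
  have hint : IntervalIntegrable (fun s => (n + 1) * (q s * Q s ^ n)) volume a b :=
    (hq.mul_continuousOn (hpow n).continuousOn).const_mul _
  have hderiv : ∀ᵐ s, s ∈ uIcc a b →
      HasDerivAt (fun t => Q t ^ (n + 1)) ((n + 1) * (q s * Q s ^ n)) s := by
    filter_upwards [hq.ae_hasDerivAt_integral] with s hs hsab
    exact ((hs hsab a left_mem_uIcc).pow (n + 1)).congr_deriv (by push_cast; simp [Q]; ring)
  have hQpow := eq_add_integral_of_ae_hasDerivAt (hpow (n + 1)) hint hderiv ht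
  rw [intervalIntegral.integral_const_mul] at hQpow
  have hQa : Q a = 0 := intervalIntegral.integral_same
  rw [hQpow, hQa, zero_pow n.succ_ne_zero, zero_add, mul_div_cancel_left₀ _ (by positivity)]

theorem le_mul_primitive_pow_div_factorial {C : ℝ} (hab : a ≤ b)
    (hq : IntervalIntegrable q volume a b) (hq0 : ∀ t, 0 ≤ q t) (hy : ContinuousOn y (Icc a b))
    (hC : ∀ t ∈ Icc a b, y t ≤ C) (hle : ∀ t ∈ Icc a b, y t ≤ ∫ s in a..t, q s * y s) (n : ℕ) :
    ∀ t ∈ Icc a b, y t ≤ C * ((∫ s in a..t, q s) ^ n / n.factorial) := by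
  induction n with
  | zero => simpa using hC
  | succ n ih =>
    intro t ht
    have hsub : uIcc a t ⊆ Icc a b := uIcc_subset_Icc ⟨le_rfl, hab⟩ ht
    have hqt : IntervalIntegrable q volume a t := hq.mono_set (hsub.trans_eq (uIcc_of_le hab).symm)
    have hbound : IntervalIntegrable
        (fun s => q s * (C * ((∫ r in a..s, q r) ^ n / n.factorial))) volume a t :=
      hqt.mul_continuousOn (((absolutelyContinuousOnInterval_primitive hqt).continuousOn.pow n
        |>.div_const _).const_mul C |>.congr fun _ _ => rfl)
    calc y t ≤ ∫ s in a..t, q s * y s := hle t ht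
      _ ≤ ∫ s in a..t, q s * (C * ((∫ r in a..s, q r) ^ n / n.factorial)) :=
          intervalIntegral.integral_mono_on ht.1 (hqt.mul_continuousOn (hy.mono hsub)) hbound
            fun s hs => mul_le_mul_of_nonneg_left (ih s ⟨hs.1, hs.2.trans ht.2⟩) (hq0 s)
      _ = C / n.factorial * ∫ s in a..t, q s * (∫ r in a..s, q r) ^ n := by
          rw [← intervalIntegral.integral_const_mul]
          exact intervalIntegral.integral_congr fun s _ => by ring
      _ = C * ((∫ s in a..t, q s) ^ (n + 1) / (n + 1).factorial) := by
          rw [integral_mul_primitive_pow hqt n right_mem_uIcc, Nat.factorial_succ]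
          push_cast
          field_simp

-- Grönwall's lemma for a merely integrable coefficient: iterate the bound and let `n → ∞`.
theorem nonpos_of_le_integral_mul (hab : a ≤ b) (hq : IntervalIntegrable q volume a b)
    (hq0 : ∀ t, 0 ≤ q t) (hy : ContinuousOn y (Icc a b))
    (hle : ∀ t ∈ Icc a b, y t ≤ ∫ s in a..t, q s * y s) : ∀ t ∈ Icc a b, y t ≤ 0 := by
  obtain ⟨C, hC⟩ := isCompact_Icc.exists_bound_of_continuousOn hy
  intro t ht
  refine ge_of_tendsto' (x := Filter.atTop) ?_ fun n =>
    le_mul_primitive_pow_div_factorial hab hq hq0 hy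
      (fun s hs => (le_abs_self _).trans (hC s hs)) hle n t ht
  simpa using (FloorSemiring.tendsto_pow_div_factorial_atTop (∫ s in a..t, q s)).const_mul C

variable {l : ℝ} {V : ℝ → ℝ} {z : ℂ} {φ : ℝ → ℂ}

theorem IsEdgeSolution.edgeDeriv_eq_integral (hl : 0 ≤ l) (hφ : IsEdgeSolution l V z 0 φ)
    (h0 : edgeDeriv l φ 0 = 0) {t : ℝ} (ht : t ∈ Icc 0 l) :
    edgeDeriv l φ t = ∫ s in (0 : ℝ)..t, ((V s : ℂ) - z) * φ s := by
  rw [hφ.1.2.eq_add_integral hl ht, h0, zero_add]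
  refine intervalIntegral.integral_congr_ae ?_
  filter_upwards [(ae_edgeMeasure_iff _).1 hφ.2] with s hs hst
  have heq := hs (uIcc_subset_Icc ⟨le_rfl, hl⟩ ht (uIoc_subset_uIcc hst))
  simp only [schrodinger, Pi.zero_apply] at heq
  linear_combination -heq

theorem IsEdgeSolution.norm_add_norm_edgeDeriv_le (hl : 0 ≤ l)
    (hVz : IntervalIntegrable (fun t => (V t : ℂ) - z) volume 0 l)
    (hφ : IsEdgeSolution l V z 0 φ) (h0 : φ 0 = 0) (h0' : edgeDeriv l φ 0 = 0)
    {t : ℝ} (ht : t ∈ Icc 0 l) :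
    ‖φ t‖ + ‖edgeDeriv l φ t‖
      ≤ ∫ s in (0 : ℝ)..t, (1 + ‖(V s : ℂ) - z‖) * (‖φ s‖ + ‖edgeDeriv l φ s‖) := by
  have hsub : uIcc 0 t ⊆ Icc 0 l := uIcc_subset_Icc ⟨le_rfl, hl⟩ ht
  have hφc : ContinuousOn (fun s => ‖φ s‖) (uIcc 0 t) := (hφ.1.1.continuousOn.mono hsub).norm
  have hφc' : ContinuousOn (fun s => ‖edgeDeriv l φ s‖) (uIcc 0 t) :=
    ((hφ.1.2.continuousOn hl).mono hsub).norm
  have hq : IntervalIntegrable (fun s => ‖(V s : ℂ) - z‖) volume 0 t :=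
    (hVz.mono_set (hsub.trans_eq (uIcc_of_le hl).symm)).norm
  have hφt : ‖φ t‖ ≤ ∫ s in (0 : ℝ)..t, ‖edgeDeriv l φ s‖ := by
    rw [(hφ.1.memH1 hl).eq_add_integral hl ht, h0, zero_add]
    exact intervalIntegral.norm_integral_le_integral_norm ht.1
  have hφt' : ‖edgeDeriv l φ t‖ ≤ ∫ s in (0 : ℝ)..t, ‖(V s : ℂ) - z‖ * ‖φ s‖ := by
    rw [hφ.edgeDeriv_eq_integral hl h0' ht]
    simpa only [norm_mul] using intervalIntegral.norm_integral_le_integral_norm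
      (f := fun s => ((V s : ℂ) - z) * φ s) (μ := volume) ht.1
  refine (add_le_add hφt hφt').trans ?_
  rw [← intervalIntegral.integral_add hφc'.intervalIntegrable (hq.mul_continuousOn hφc)]
  refine intervalIntegral.integral_mono_on ht.1
    (hφc'.intervalIntegrable.add (hq.mul_continuousOn hφc))
    ((intervalIntegrable_const.add hq).mul_continuousOn (hφc.add hφc')) fun s _ => ?_
  nlinarith [norm_nonneg (φ s), mul_nonneg (norm_nonneg ((V s : ℂ) - z))
    (norm_nonneg (edgeDeriv l φ s))]

theorem IsEdgeSolution.eqOn_zero_of_initial_eq_zero (hl : 0 ≤ l)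
    (hV : IntervalIntegrable V volume 0 l) (hφ : IsEdgeSolution l V z 0 φ) (h0 : φ 0 = 0)
    (h0' : edgeDeriv l φ 0 = 0) : EqOn φ 0 (Icc 0 l) := by
  intro t ht
  have hVz : IntervalIntegrable (fun s => (V s : ℂ) - z) volume 0 l :=
    IntervalIntegrable.sub ⟨hV.1.ofReal, hV.2.ofReal⟩ intervalIntegrable_const
  have hle : ‖φ t‖ + ‖edgeDeriv l φ t‖ ≤ 0 :=
    nonpos_of_le_integral_mul hl (intervalIntegrable_const.add hVz.norm) (fun s => by positivity)
      (hφ.1.1.continuousOn.norm.add (hφ.1.2.continuousOn hl).norm)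
      (fun s hs => hφ.norm_add_norm_edgeDeriv_le hl hVz h0 h0' hs) t ht
  exact norm_le_zero_iff.1 (by linarith [norm_nonneg (edgeDeriv l φ t)])

end InitialValues

/-! ### The Dirichlet problem on an edge -/

section Dirichlet

variable {l : ℝ} {V : ℝ → ℝ} {z : ℂ}

theorem ae_add_smul_eq_schrodinger_iff {h f : EdgeSpace l} {φ : ℝ → ℂ}
    (hf : f =ᵐ[edgeMeasure l] φ) :
    (h + z • f : EdgeSpace l) =ᵐ[edgeMeasure l] schrodinger l V φ ↔
      ∀ᵐ t ∂(edgeMeasure l), schrodinger l V φ t = h t + z * φ t := by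
  refine Filter.eventually_congr ?_
  filter_upwards [Lp.coeFn_add h (z • f), Lp.coeFn_smul z f, hf] with t hadd hsmul hft
  rw [hadd, Pi.add_apply, hsmul, Pi.smul_apply, hft, smul_eq_mul, eq_comm]

theorem dirichletResolvent_eq_iff (hl : 0 < l) (hz : z ∈ resolventSet (dirichletOperator l V))
    {h f : EdgeSpace l} : resolventOperator hz h = f ↔
      ∃ φ, IsEdgeSolution l V z h φ ∧ φ 0 = 0 ∧ φ l = 0 ∧ f =ᵐ[edgeMeasure l] φ := by
  rw [resolventOperator_eq_iff, dirichletOperator_graph hl]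
  constructor
  · rintro ⟨φ, hφ, hφ0, hφl, hf, hg⟩
    exact ⟨φ, ⟨hφ, (ae_add_smul_eq_schrodinger_iff hf).1 hg⟩, hφ0, hφl, hf⟩
  · rintro ⟨φ, hφ, hφ0, hφl, hf⟩
    exact ⟨φ, hφ.1, hφ0, hφl, hf, (ae_add_smul_eq_schrodinger_iff hf).2 hφ.2⟩

theorem IsEdgeSolution.eqOn_zero_of_boundary_eq_zero (hl : 0 < l)
    (hz : z ∈ resolventSet (dirichletOperator l V)) {φ : ℝ → ℂ} (hφ : IsEdgeSolution l V z 0 φ)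
    (hφ0 : φ 0 = 0) (hφl : φ l = 0) : EqOn φ 0 (Icc 0 l) := by
  have hzero : ⇑(0 : EdgeSpace l) =ᵐ[edgeMeasure l] 0 := Lp.coeFn_zero _ _ _
  have hR : resolventOperator hz 0 = hφ.1.memLp.toLp φ := (dirichletResolvent_eq_iff hl hz).2
    ⟨φ, hφ.congr hzero.symm, hφ0, hφl, hφ.1.memLp.coeFn_toLp⟩
  rw [map_zero] at hR
  refine eqOn_of_ae_eq hl hφ.1 (memH2_zero l) (hφ.1.memLp.coeFn_toLp.symm.trans ?_)
  rwa [← hR]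

theorem exists_isEdgeSolution_of_memH2 (hl : 0 ≤ l) (hV : MemLp V 2 (edgeMeasure l)) (z : ℂ)
    {u : ℝ → ℂ} (hu : MemH2 l u) : ∃ h : EdgeSpace l, IsEdgeSolution l V z h u := by
  have hh : MemLp (fun t => schrodinger l V u t - z * u t) 2 (edgeMeasure l) :=
    (hu.memLp_schrodinger hl hV).sub (hu.memLp.const_smul z)
  refine ⟨hh.toLp _, hu, ?_⟩
  filter_upwards [hh.coeFn_toLp] with t ht
  rw [ht, sub_add_cancel]

-- Correct an affine function with the right boundary values by a Dirichlet solution.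
theorem exists_isEdgeSolution_boundary_eq (hl : 0 < l) (hV : MemLp V 2 (edgeMeasure l))
    (hz : z ∈ resolventSet (dirichletOperator l V)) (h : EdgeSpace l) (a b : ℂ) :
    ∃ φ, IsEdgeSolution l V z h φ ∧ φ 0 = a ∧ φ l = b := by
  have haffine : MemH2 l (fun t : ℝ => a + (b - a) * ((t / l : ℝ) : ℂ)) :=
    memH2_of_contDiff hl (contDiff_const.add (contDiff_const.mul
      (Complex.ofRealCLM.contDiff.comp (contDiff_id.div_const l))))
  obtain ⟨k, hk⟩ := exists_isEdgeSolution_of_memH2 hl.le hV z haffine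
  obtain ⟨φ, hφ, hφ0, hφl, -⟩ := (dirichletResolvent_eq_iff hl hz (h := h - k)).1 rfl
  refine ⟨_, (hφ.add hk).congr ?_, by simp [hφ0], by simp [hφl, hl.ne']⟩
  filter_upwards [Lp.coeFn_sub h k] with t ht
  rw [Pi.add_apply, ht, Pi.sub_apply, sub_add_cancel]

theorem isSolution_iff {c₀ c₁ : ℂ} {u : ℝ → ℂ} : IsSolution l V z c₀ c₁ u ↔
    IsEdgeSolution l V z 0 u ∧ u 0 = c₀ ∧ edgeDeriv l u 0 = c₁ := by
  simp only [IsSolution, IsEdgeSolution, Pi.zero_apply, zero_add, and_assoc]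

-- The solution vanishing at `0` has a nonzero slope there, so that it can be used to adjust `c₁`.
theorem exists_isSolution (hl : 0 < l) (hV : MemLp V 2 (edgeMeasure l))
    (hz : z ∈ resolventSet (dirichletOperator l V)) (c₀ c₁ : ℂ) :
    ∃ u, IsSolution l V z c₀ c₁ u := by
  have h0 : (0 : ℝ) ∈ Icc 0 l := left_mem_Icc.2 hl.le
  have hzero : ⇑(0 : EdgeSpace l) =ᵐ[edgeMeasure l] 0 := Lp.coeFn_zero _ _ _
  obtain ⟨v, hv, hv0, -⟩ := exists_isEdgeSolution_boundary_eq hl hV hz 0 c₀ 0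
  obtain ⟨w, hw, hw0, hwl⟩ := exists_isEdgeSolution_boundary_eq hl hV hz 0 0 1
  have hslope : edgeDeriv l w 0 ≠ 0 := fun hw0' => by
    have hwzero := (hw.congr hzero).eqOn_zero_of_initial_eq_zero hl.le
      (intervalIntegrable_of_memLp_edgeMeasure hl.le hV) hw0 hw0' (right_mem_Icc.2 hl.le)
    exact one_ne_zero (hwl.symm.trans hwzero)
  refine ⟨v + ((c₁ - edgeDeriv l v 0) / edgeDeriv l w 0) • w, isSolution_iff.2 ⟨?_, ?_, ?_⟩⟩
  · simpa using (hv.congr hzero).add ((hw.congr hzero).smul _)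
  · simp [hv0, hw0]
  · rw [edgeDeriv_add hv.1.1 (hw.1.1.const_smul _) h0, Pi.add_apply, edgeDeriv_smul hw.1.1 _ h0,
      Pi.smul_apply, smul_eq_mul, div_mul_cancel₀ _ hslope, add_sub_cancel]

theorem isSolution_solution (hl : 0 < l) (hV : MemLp V 2 (edgeMeasure l))
    (hz : z ∈ resolventSet (dirichletOperator l V)) (c₀ c₁ : ℂ) :
    IsSolution l V z c₀ c₁ (solution l V z c₀ c₁) := by
  have hex := exists_isSolution hl hV hz c₀ c₁
  rw [solution, dif_pos hex]
  exact hex.choose_spec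

end Dirichlet

/-! ### The Krein matrix of an edge -/

section KreinMatrix

variable {l : ℝ} {V : ℝ → ℝ} {z : ℂ}

theorem u₁_spec (hl : 0 < l) (hV : MemLp V 2 (edgeMeasure l))
    (hz : z ∈ resolventSet (dirichletOperator l V)) :
    IsEdgeSolution l V z 0 (u₁ l V z) ∧ u₁ l V z 0 = 0 ∧ edgeDeriv l (u₁ l V z) 0 = 1 :=
  isSolution_iff.1 (isSolution_solution hl hV hz 0 1)

theorem u₂_spec (hl : 0 < l) (hV : MemLp V 2 (edgeMeasure l))
    (hz : z ∈ resolventSet (dirichletOperator l V)) :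
    IsEdgeSolution l V z 0 (u₂ l V z) ∧ u₂ l V z 0 = 1 ∧ edgeDeriv l (u₂ l V z) 0 = 0 :=
  isSolution_iff.1 (isSolution_solution hl hV hz 1 0)

theorem u₁_end_ne_zero (hl : 0 < l) (hV : MemLp V 2 (edgeMeasure l))
    (hz : z ∈ resolventSet (dirichletOperator l V)) : u₁ l V z l ≠ 0 := fun hul => by
  obtain ⟨hu, hu0, hu0'⟩ := u₁_spec hl hV hz
  have hzero := edgeDeriv_congr (hu.eqOn_zero_of_boundary_eq_zero hl hz hu0 hul)
    (left_mem_Icc.2 hl.le)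
  rw [hu0', edgeDeriv_zero] at hzero
  exact one_ne_zero hzero

theorem wronskian_u₁_u₂_end (hl : 0 < l) (hV : MemLp V 2 (edgeMeasure l))
    (hz : z ∈ resolventSet (dirichletOperator l V)) :
    edgeDeriv l (u₁ l V z) l * u₂ l V z l - u₁ l V z l * edgeDeriv l (u₂ l V z) l = 1 := by
  obtain ⟨h₁, h₁0, h₁0'⟩ := u₁_spec hl hV hz
  obtain ⟨h₂, h₂0, -⟩ := u₂_spec hl hV hz
  have hgreen := h₁.green hl.le h₂
  simp only [Pi.zero_apply, zero_mul, mul_zero, sub_zero, integral_zero, h₁0, h₁0', h₂0] at hgreen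
  linear_combination hgreen

/-- The solution of `-φ'' + V φ = z φ` on the edge with `φ(0) = 1` and `φ(l) = 0`. -/
def leftProfile (l : ℝ) (V : ℝ → ℝ) (z : ℂ) : ℝ → ℂ :=
  u₂ l V z + (-(u₂ l V z l / u₁ l V z l)) • u₁ l V z

/-- The solution of `-φ'' + V φ = z φ` on the edge with `φ(0) = 0` and `φ(l) = 1`. -/
def rightProfile (l : ℝ) (V : ℝ → ℝ) (z : ℂ) : ℝ → ℂ :=
  (u₁ l V z l)⁻¹ • u₁ l V z

theorem isEdgeSolution_leftProfile (hl : 0 < l) (hV : MemLp V 2 (edgeMeasure l))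
    (hz : z ∈ resolventSet (dirichletOperator l V)) :
    IsEdgeSolution l V z 0 (leftProfile l V z) := by
  simpa only [leftProfile, smul_zero, add_zero] using
    (u₂_spec hl hV hz).1.add ((u₁_spec hl hV hz).1.smul _)

theorem isEdgeSolution_rightProfile (hl : 0 < l) (hV : MemLp V 2 (edgeMeasure l))
    (hz : z ∈ resolventSet (dirichletOperator l V)) :
    IsEdgeSolution l V z 0 (rightProfile l V z) := by
  simpa only [rightProfile, smul_zero] using (u₁_spec hl hV hz).1.smul _

theorem leftProfile_boundary (hl : 0 < l) (hV : MemLp V 2 (edgeMeasure l))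
    (hz : z ∈ resolventSet (dirichletOperator l V)) :
    leftProfile l V z 0 = 1 ∧ leftProfile l V z l = 0 := by
  simp [leftProfile, (u₁_spec hl hV hz).2.1, (u₂_spec hl hV hz).2.1, u₁_end_ne_zero hl hV hz]

theorem rightProfile_boundary (hl : 0 < l) (hV : MemLp V 2 (edgeMeasure l))
    (hz : z ∈ resolventSet (dirichletOperator l V)) :
    rightProfile l V z 0 = 0 ∧ rightProfile l V z l = 1 := by
  simp [rightProfile, (u₁_spec hl hV hz).2.1, u₁_end_ne_zero hl hV hz]

theorem edgeDeriv_leftProfile (hl : 0 < l) (hV : MemLp V 2 (edgeMeasure l))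
    (hz : z ∈ resolventSet (dirichletOperator l V)) :
    edgeDeriv l (leftProfile l V z) 0 = kreinMatrix l V z 0 0 ∧
      edgeDeriv l (leftProfile l V z) l = -kreinMatrix l V z 1 0 := by
  obtain ⟨h₁, -, h₁0'⟩ := u₁_spec hl hV hz
  obtain ⟨h₂, -, h₂0'⟩ := u₂_spec hl hV hz
  have hne := u₁_end_ne_zero hl hV hz
  have hderiv : ∀ t ∈ Icc 0 l, edgeDeriv l (leftProfile l V z) t
      = edgeDeriv l (u₂ l V z) t - u₂ l V z l / u₁ l V z l * edgeDeriv l (u₁ l V z) t :=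
    fun t ht => by
      rw [leftProfile, edgeDeriv_add h₂.1.1 (h₁.1.1.const_smul _) ht, Pi.add_apply,
        edgeDeriv_smul h₁.1.1 _ ht, Pi.smul_apply, smul_eq_mul, neg_mul, ← sub_eq_add_neg]
  rw [hderiv 0 (left_mem_Icc.2 hl.le), hderiv l (right_mem_Icc.2 hl.le), h₁0', h₂0']
  constructor
  · simp [kreinMatrix, div_eq_inv_mul]
  · simp only [kreinMatrix, Matrix.smul_apply, Matrix.of_apply, Matrix.cons_val',
      Matrix.cons_val_zero, Matrix.cons_val_one, smul_eq_mul]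
    field_simp
    linear_combination -wronskian_u₁_u₂_end hl hV hz

theorem edgeDeriv_rightProfile (hl : 0 < l) (hV : MemLp V 2 (edgeMeasure l))
    (hz : z ∈ resolventSet (dirichletOperator l V)) :
    edgeDeriv l (rightProfile l V z) 0 = kreinMatrix l V z 0 1 ∧
      edgeDeriv l (rightProfile l V z) l = -kreinMatrix l V z 1 1 := by
  obtain ⟨h₁, -, h₁0'⟩ := u₁_spec hl hV hz
  rw [rightProfile, edgeDeriv_smul h₁.1.1 _ (left_mem_Icc.2 hl.le),
    edgeDeriv_smul h₁.1.1 _ (right_mem_Icc.2 hl.le), Pi.smul_apply, Pi.smul_apply, h₁0']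
  simp [kreinMatrix]

/-- The bilinear pairing `∫ f g` on `L²[0, l]`. -/
def pairing (l : ℝ) : EdgeSpace l →L[ℂ] EdgeSpace l →L[ℂ] ℂ :=
  (ContinuousLinearMap.mul ℂ ℂ).lpPairing (edgeMeasure l) 2 2

theorem pairing_eq_integral {f g : EdgeSpace l} {φ ψ : ℝ → ℂ} (hf : f =ᵐ[edgeMeasure l] φ)
    (hg : g =ᵐ[edgeMeasure l] ψ) : pairing l f g = ∫ t, φ t * ψ t ∂(edgeMeasure l) := by
  rw [pairing, ContinuousLinearMap.lpPairing_eq_integral]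
  refine integral_congr_ae ?_
  filter_upwards [hf, hg] with t hft hgt
  rw [ContinuousLinearMap.mul_apply', hft, hgt]

theorem pairing_comm (f g : EdgeSpace l) : pairing l f g = pairing l g f := by
  simp only [pairing_eq_integral (ae_eq_refl _) (ae_eq_refl _), mul_comm]

/-- The solution `leftProfile` as an element of `L²[0, l]`. -/
def leftMode (hl : 0 < l) (hV : MemLp V 2 (edgeMeasure l))
    (hz : z ∈ resolventSet (dirichletOperator l V)) : EdgeSpace l :=
  (isEdgeSolution_leftProfile hl hV hz).1.memLp.toLp (leftProfile l V z)

/-- The solution `rightProfile` as an element of `L²[0, l]`. -/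
def rightMode (hl : 0 < l) (hV : MemLp V 2 (edgeMeasure l))
    (hz : z ∈ resolventSet (dirichletOperator l V)) : EdgeSpace l :=
  (isEdgeSolution_rightProfile hl hV hz).1.memLp.toLp (rightProfile l V z)

theorem coeFn_leftMode (hl : 0 < l) (hV : MemLp V 2 (edgeMeasure l))
    (hz : z ∈ resolventSet (dirichletOperator l V)) :
    leftMode hl hV hz =ᵐ[edgeMeasure l] leftProfile l V z :=
  MemLp.coeFn_toLp _

theorem coeFn_rightMode (hl : 0 < l) (hV : MemLp V 2 (edgeMeasure l))
    (hz : z ∈ resolventSet (dirichletOperator l V)) :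
    rightMode hl hV hz =ᵐ[edgeMeasure l] rightProfile l V z :=
  MemLp.coeFn_toLp _

theorem IsEdgeSolution.edgeDeriv_start (hl : 0 < l) (hV : MemLp V 2 (edgeMeasure l))
    (hz : z ∈ resolventSet (dirichletOperator l V)) {h : EdgeSpace l} {φ : ℝ → ℂ}
    (hφ : IsEdgeSolution l V z h φ) : edgeDeriv l φ 0 = pairing l (leftMode hl hV hz) h
      + (kreinMatrix l V z 0 0 * φ 0 + kreinMatrix l V z 1 0 * φ l) := by
  obtain ⟨hv0, hvl⟩ := leftProfile_boundary hl hV hz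
  obtain ⟨hv0', hvl'⟩ := edgeDeriv_leftProfile hl hV hz
  have hgreen := hφ.green hl.le (isEdgeSolution_leftProfile hl hV hz)
  simp only [Pi.zero_apply, mul_zero, sub_zero, hv0, hvl, hv0', hvl', mul_one] at hgreen
  rw [pairing_comm, pairing_eq_integral (ae_eq_refl _) (coeFn_leftMode hl hV hz), hgreen]
  ring

theorem IsEdgeSolution.edgeDeriv_end (hl : 0 < l) (hV : MemLp V 2 (edgeMeasure l))
    (hz : z ∈ resolventSet (dirichletOperator l V)) {h : EdgeSpace l} {φ : ℝ → ℂ}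
    (hφ : IsEdgeSolution l V z h φ) : edgeDeriv l φ l = -(pairing l (rightMode hl hV hz) h
      + (kreinMatrix l V z 0 1 * φ 0 + kreinMatrix l V z 1 1 * φ l)) := by
  obtain ⟨hw0, hwl⟩ := rightProfile_boundary hl hV hz
  obtain ⟨hw0', hwl'⟩ := edgeDeriv_rightProfile hl hV hz
  have hgreen := hφ.green hl.le (isEdgeSolution_rightProfile hl hV hz)
  simp only [Pi.zero_apply, mul_zero, sub_zero, hw0, hwl, hw0', hwl', mul_one] at hgreen
  rw [pairing_comm, pairing_eq_integral (ae_eq_refl _) (coeFn_rightMode hl hV hz), hgreen]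
  ring

theorem IsEdgeSolution.ae_eq (hl : 0 < l) (hV : MemLp V 2 (edgeMeasure l))
    (hz : z ∈ resolventSet (dirichletOperator l V)) {h : EdgeSpace l} {φ : ℝ → ℂ}
    (hφ : IsEdgeSolution l V z h φ) : (resolventOperator hz h
      + (φ 0 • leftMode hl hV hz + φ l • rightMode hl hV hz) : EdgeSpace l)
        =ᵐ[edgeMeasure l] φ := by
  set v := leftMode hl hV hz
  set w := rightMode hl hV hz
  obtain ⟨hv0, hvl⟩ := leftProfile_boundary hl hV hz
  obtain ⟨hw0, hwl⟩ := rightProfile_boundary hl hV hz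
  have hψ := hφ.add (((isEdgeSolution_leftProfile hl hV hz).smul (-φ 0)).add
    ((isEdgeSolution_rightProfile hl hV hz).smul (-φ l)))
  rw [smul_zero, smul_zero, add_zero, add_zero] at hψ
  have hR : resolventOperator hz h = hφ.1.memLp.toLp φ + ((-φ 0) • v + (-φ l) • w) :=
    (dirichletResolvent_eq_iff hl hz).2 ⟨_, hψ, by simp [hv0, hw0], by simp [hvl, hwl],
      (Lp.coeFn_add _ _).trans <| hφ.1.memLp.coeFn_toLp.add <| (Lp.coeFn_add _ _).trans <|
        ((Lp.coeFn_smul _ _).trans ((coeFn_leftMode hl hV hz).const_smul _)).add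
          ((Lp.coeFn_smul _ _).trans ((coeFn_rightMode hl hV hz).const_smul _))⟩
  rw [hR, show hφ.1.memLp.toLp φ + ((-φ 0) • v + (-φ l) • w) + (φ 0 • v + φ l • w)
    = hφ.1.memLp.toLp φ by module]
  exact hφ.1.memLp.coeFn_toLp

theorem exists_memH2_bump (hl : 0 < l) : ∃ η : ℝ → ℂ, MemH2 l η ∧ η 0 = 0 ∧ η l = 0 ∧
    edgeDeriv l η 0 = 1 ∧ edgeDeriv l η l = 0 := by
  have hderiv : ∀ t : ℝ, HasDerivAt (fun t : ℝ => ((t * (1 - t / l) ^ 2 : ℝ) : ℂ))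
      (((1 - t / l) ^ 2 + t * (2 * (1 - t / l) * (-(1 / l))) : ℝ) : ℂ) t := fun t => by
    have hsub : HasDerivAt (fun t : ℝ => 1 - t / l) (-(1 / l)) t :=
      ((hasDerivAt_id t).div_const l).const_sub 1
    exact (((hasDerivAt_id t).mul (hsub.pow 2)).congr_deriv (by simp)).ofReal_comp
  have hedge := fun t ht => edgeDeriv_eq_of_hasDerivWithinAt hl ht (hderiv t).hasDerivWithinAt
  refine ⟨_, memH2_of_contDiff hl (Complex.ofRealCLM.contDiff.comp
    (contDiff_id.mul ((contDiff_const.sub (contDiff_id.div_const l)).pow 2))), by simp,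
    by simp [hl.ne'], (hedge 0 (left_mem_Icc.2 hl.le)).trans (by simp),
    (hedge l (right_mem_Icc.2 hl.le)).trans (by simp [hl.ne'])⟩

-- `χ = -η'' + V η - z η` for a bump `η` with `η'(0) = 1` and all other boundary data zero.
theorem exists_pairing_modes_eq (hl : 0 < l) (hV : MemLp V 2 (edgeMeasure l))
    (hz : z ∈ resolventSet (dirichletOperator l V)) : ∃ χ : EdgeSpace l,
      pairing l (leftMode hl hV hz) χ = 1 ∧ pairing l (rightMode hl hV hz) χ = 0 := by
  obtain ⟨η, hη, hη0, hηl, hη0', hηl'⟩ := exists_memH2_bump hl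
  obtain ⟨χ, hχ⟩ := exists_isEdgeSolution_of_memH2 hl.le hV z hη
  have hstart := hχ.edgeDeriv_start hl hV hz
  have hend := hχ.edgeDeriv_end hl hV hz
  simp only [hη0, hηl, hη0', hηl', mul_zero, add_zero] at hstart hend
  exact ⟨χ, hstart.symm, neg_eq_zero.1 hend.symm⟩

end KreinMatrix

/-! ### Weighted composition operators on `ℓᵖ` sums -/

section WeightedComposition

variable {𝕜 I J : Type*} [NontriviallyNormedField 𝕜] {E : I → Type*} {E' : J → Type*}
  [∀ i, NormedAddCommGroup (E i)] [∀ i, NormedSpace 𝕜 (E i)]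
  [∀ j, NormedAddCommGroup (E' j)] [∀ j, NormedSpace 𝕜 (E' j)]
  {p : ENNReal} {σ : J → I} {N : ℕ} {B : ∀ j, E (σ j) →L[𝕜] E' j} {C : NNReal}

theorem sum_comp_le_of_encard_fiber_le [DecidableEq I]
    (hσ : ∀ i, (σ ⁻¹' {i}).encard ≤ N) {a : I → ℝ} (ha : ∀ i, 0 ≤ a i) (s : Finset J) :
    ∑ j ∈ s, a (σ j) ≤ N * ∑ i ∈ s.image σ, a i := by
  rw [Finset.sum_comp, Finset.mul_sum]
  refine Finset.sum_le_sum fun i _ => ?_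
  rw [nsmul_eq_mul]
  refine mul_le_mul_of_nonneg_right (Nat.cast_le.2 ?_) (ha i)
  rw [← Nat.cast_le (α := ℕ∞), ← encard_coe_eq_coe_finsetCard, Finset.coe_filter]
  exact (encard_le_encard fun j hj => hj.2).trans (hσ i)

theorem sum_norm_rpow_weightedComposition_le (hp : 0 < p.toReal)
    (hσ : ∀ i, (σ ⁻¹' {i}).encard ≤ N) (hB : ∀ j, ‖B j‖ ≤ C) (x : lp E p) (s : Finset J) :
    ∑ j ∈ s, ‖B j (x (σ j))‖ ^ p.toReal
      ≤ ((N : ℝ) ^ p.toReal⁻¹ * C * ‖x‖) ^ p.toReal := by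
  classical
  calc ∑ j ∈ s, ‖B j (x (σ j))‖ ^ p.toReal
      ≤ ∑ j ∈ s, (C : ℝ) ^ p.toReal * ‖x (σ j)‖ ^ p.toReal := Finset.sum_le_sum fun j _ =>
        (Real.rpow_le_rpow (norm_nonneg _) ((B j).le_of_opNorm_le (hB j) _) hp.le).trans_eq
          (Real.mul_rpow C.coe_nonneg (norm_nonneg _))
    _ ≤ (C : ℝ) ^ p.toReal * (N * ∑ i ∈ s.image σ, ‖x i‖ ^ p.toReal) := by
        rw [← Finset.mul_sum]
        gcongr
        exact sum_comp_le_of_encard_fiber_le (a := fun i => ‖x i‖ ^ p.toReal) hσ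
          (fun i => by positivity) s
    _ ≤ (C : ℝ) ^ p.toReal * (N * ‖x‖ ^ p.toReal) := by
        gcongr
        exact lp.sum_rpow_le_norm_rpow hp x _
    _ = ((N : ℝ) ^ p.toReal⁻¹ * C * ‖x‖) ^ p.toReal := by
        rw [Real.mul_rpow (by positivity) (lp.norm_nonneg' x),
          Real.mul_rpow (by positivity) C.coe_nonneg,
          Real.rpow_inv_rpow N.cast_nonneg hp.ne']
        ring

/-- The operator `(T x)ⱼ = Bⱼ x_{σ j}` between `ℓᵖ` sums of normed spaces, bounded because the `Bⱼ`
are uniformly bounded and the fibres of `σ` have at most `N` elements. -/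
def weightedComposition [Fact (1 ≤ p)] (hp : p ≠ ⊤) (hσ : ∀ i, (σ ⁻¹' {i}).encard ≤ N)
    (hB : ∀ j, ‖B j‖ ≤ C) : lp E p →L[𝕜] lp E' p :=
  have hp' : 0 < p.toReal := ENNReal.toReal_pos (zero_lt_one.trans_le Fact.out).ne' hp
  LinearMap.mkContinuous
    { toFun := fun x => ⟨fun j => B j (x (σ j)),
        memℓp_gen' (sum_norm_rpow_weightedComposition_le hp' hσ hB x)⟩
      map_add' := fun x y => lp.ext (funext fun j => map_add (B j) (x (σ j)) (y (σ j)))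
      map_smul' := fun c x => lp.ext (funext fun j => map_smul (B j) c (x (σ j))) }
    ((N : ℝ) ^ p.toReal⁻¹ * C)
    fun x => lp.norm_le_of_forall_sum_le hp' (by positivity)
      (sum_norm_rpow_weightedComposition_le hp' hσ hB x)

theorem weightedComposition_apply [Fact (1 ≤ p)] (hp : p ≠ ⊤)
    (hσ : ∀ i, (σ ⁻¹' {i}).encard ≤ N) (hB : ∀ j, ‖B j‖ ≤ C) (x : lp E p) (j : J) :
    weightedComposition hp hσ hB x j = B j (x (σ j)) :=
  rfl

theorem encard_fiber_le_one (hσ : Function.Injective σ) (i : I) :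
    (σ ⁻¹' {i}).encard ≤ (1 : ℕ) := by
  rw [Nat.cast_one, encard_le_one_iff_subsingleton]
  exact subsingleton_singleton.preimage hσ

end WeightedComposition

/-! ### Phase factors on `L²[0, l]` -/

section PhaseOperator

variable {l : ℝ} {P : ℝ → ℝ}

theorem memLp_phase (l : ℝ) (hP : Continuous P) :
    MemLp (fun t => Complex.exp (Complex.I * P t)) ⊤ (edgeMeasure l) :=
  memLp_top_of_bound (by fun_prop : Continuous _).aestronglyMeasurable 1 <|
    .of_forall fun t => by rw [mul_comm, Complex.norm_exp_ofReal_mul_I]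

/-- Multiplication by `exp (i P)` on `L²[0, l]`. -/
def phaseOperator (l : ℝ) (hP : Continuous P) : EdgeSpace l →L[ℂ] EdgeSpace l :=
  (ContinuousLinearMap.mul ℂ ℂ).holderL (edgeMeasure l) ⊤ 2 2 (memLp_phase l hP).toLp

theorem coeFn_phaseOperator (hP : Continuous P) (f : EdgeSpace l) :
    phaseOperator l hP f =ᵐ[edgeMeasure l] phaseMul P f := by
  filter_upwards [ContinuousLinearMap.coeFn_holder (r := 2) (B := ContinuousLinearMap.mul ℂ ℂ)
    (memLp_phase l hP).toLp f, (memLp_phase l hP).coeFn_toLp] with t hholder hphase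
  rw [phaseMul, ← hphase]
  exact hholder

theorem norm_phaseOperator_le (l : ℝ) (hP : Continuous P) : ‖phaseOperator l hP‖ ≤ 1 :=
  ContinuousLinearMap.opNorm_le_bound _ zero_le_one fun f => by
    rw [one_mul]
    refine Lp.norm_le_norm_of_ae_le ?_
    filter_upwards [coeFn_phaseOperator hP f] with t ht
    rw [ht, norm_phaseMul]

theorem phaseOperator_phaseOperator_neg (hP : Continuous P) (f : EdgeSpace l) :
    phaseOperator l hP (phaseOperator l hP.neg f) = f := by
  refine Lp.ext ?_
  filter_upwards [coeFn_phaseOperator hP (phaseOperator l hP.neg f),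
    coeFn_phaseOperator hP.neg f] with t houter hinner
  rw [houter, phaseMul, hinner]
  exact congrFun (phaseMul_phaseMul_neg P f) t

theorem phaseOperator_neg_phaseOperator (hP : Continuous P) (f : EdgeSpace l) :
    phaseOperator l hP.neg (phaseOperator l hP f) = f := by
  simpa only [neg_neg] using phaseOperator_phaseOperator_neg hP.neg f

end PhaseOperator

/-! ### The vertex conditions of the lattice -/

section VertexConditions

variable {l α β θ : ℝ}

/-- The node at the parameter `0` of an edge. -/
def startNode (e : Edge) : ℤ × ℤ := (e.1, e.2.1)

/-- The node at the parameter `l` of an edge. -/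
def endNode : Edge → ℤ × ℤ
  | (m, n, .right) => (m + 1, n)
  | (m, n, .up) => (m, n + 1)

/-- The weight of an edge in the vertex conditions: `1` for horizontal and `β` for vertical
edges. -/
def edgeWeight (β : ℝ) : Edge → ℂ
  | (_, _, .right) => 1
  | (_, _, .up) => β

/-- The Peierls phase that a particle picks up along an edge, in the symmetric gauge. -/
def peierlsPhase (θ : ℝ) : Edge → ℝ
  | (_, n, .right) => Real.pi * n * θ
  | (m, _, .up) => -(Real.pi * m * θ)

/-- The hopping factor `exp (i peierlsPhase)` of an edge. -/
def peierlsFactor (θ : ℝ) (e : Edge) : ℂ := Complex.exp (Complex.I * peierlsPhase θ e)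

theorem peierlsFactor_ne_zero (θ : ℝ) (e : Edge) : peierlsFactor θ e ≠ 0 := Complex.exp_ne_zero _

theorem norm_peierlsFactor (θ : ℝ) (e : Edge) : ‖peierlsFactor θ e‖ = 1 := by
  rw [peierlsFactor, mul_comm, Complex.norm_exp_ofReal_mul_I]

theorem nnnorm_edgeWeight_le (β : ℝ) (e : Edge) : ‖edgeWeight β e‖₊ ≤ 1 + ‖β‖₊ := by
  obtain ⟨m, n, _ | _⟩ := e <;> simp [edgeWeight]

/-- The weighted flux out of the node `p`, for edge data `a` at the starting points and `b` at the
end points of the edges. -/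
def netFlux (β : ℝ) (a b : Edge → ℂ) (p : ℤ × ℤ) : ℂ :=
  a (p.1, p.2, .right) + β * a (p.1, p.2, .up)
    - b (p.1 - 1, p.2, .right) - β * b (p.1, p.2 - 1, .up)

theorem netFlux_mul (β : ℝ) (c : ℤ × ℤ → ℂ) (a b : Edge → ℂ) (p : ℤ × ℤ) :
    netFlux β (fun e => c (startNode e) * a e) (fun e => c (endNode e) * b e) p
      = c p * netFlux β a b p := by
  simp only [netFlux, startNode, endNode, sub_add_cancel]
  ring

theorem netFlux_add (β : ℝ) (a a' b b' : Edge → ℂ) (p : ℤ × ℤ) :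
    netFlux β (fun e => a e + a' e) (fun e => b e + b' e) p
      = netFlux β a b p + netFlux β a' b' p := by
  simp only [netFlux]
  ring

theorem discreteMagneticLaplacian_eq_netFlux (θ β : ℝ) (g : L2Z2) (p : ℤ × ℤ) :
    discreteMagneticLaplacian θ β g p
      = netFlux β (fun e => edgeWeight β e * (peierlsFactor θ e * g (endNode e)))
          (fun e => -((peierlsFactor θ e)⁻¹ * (edgeWeight β e * g (startNode e)))) p := by
  rw [discreteMagneticLaplacian_apply]
  simp only [netFlux, edgeWeight, peierlsFactor, peierlsPhase, startNode, endNode,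
    ← Complex.exp_neg]
  push_cast
  simp only [mul_neg, neg_neg, ← mul_assoc]
  ring

/-- The vertex conditions for the boundary values `x₀`, `xₗ` and the derivatives `d₀`, `dₗ` of the
edge functions at the starting points and at the end points, with node values `g`. -/
structure NodeConditions (α β : ℝ) (x₀ xₗ d₀ dₗ : Edge → ℂ) (g : ℤ × ℤ → ℂ) : Prop where
  start : ∀ e, x₀ e = edgeWeight β e * g (startNode e)
  finish : ∀ e, xₗ e = edgeWeight β e * g (endNode e)
  flux : ∀ p, netFlux β d₀ dₗ p = α * g p

theorem vertexConditions_iff {F : PeriodicMagneticField l} (hβ : β ≠ 0) {u : Edge → ℝ → ℂ} :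
    VertexConditions F α β u ↔ ∃ g, NodeConditions α β (fun e => u e 0) (fun e => u e l)
      (fun e => covDeriv l (F.edgePotential e) (u e) 0)
      (fun e => covDeriv l (F.edgePotential e) (u e) l) g := by
  have hβ' : (β : ℂ) ≠ 0 := Complex.ofReal_ne_zero.2 hβ
  constructor
  · intro h
    refine ⟨fun p => u (p.1, p.2, .right) 0, ?_, ?_, fun p => h.flux p.1 p.2⟩
    · rintro ⟨m, n, _ | _⟩
      · exact (one_mul _).symm
      · simp [edgeWeight, startNode, ← h.up_start m n, hβ']
    · rintro ⟨m, n, _ | _⟩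
      · simpa [edgeWeight, endNode] using h.right_end (m + 1) n
      · simp [edgeWeight, endNode, ← h.up_end m (n + 1), hβ']
  · rintro ⟨g, h⟩
    have hg : ∀ m n, u (m, n, .right) 0 = g (m, n) := fun m n => by
      rw [h.start, edgeWeight, one_mul, startNode]
    refine ⟨fun m n => ?_, fun m n => ?_, fun m n => ?_, fun m n => ?_⟩
    · simp [hg, h.start (m, n, .up), edgeWeight, startNode, hβ']
    · simp [hg, h.finish (m - 1, n, .right), edgeWeight, endNode]
    · simp [hg, h.finish (m, n - 1, .up), edgeWeight, endNode, hβ']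
    · rw [hg]
      exact h.flux (m, n)

theorem NodeConditions.mul {x₀ xₗ d₀ dₗ : Edge → ℂ} {g : ℤ × ℤ → ℂ} (c : ℤ × ℤ → ℂ)
    (h : NodeConditions α β x₀ xₗ d₀ dₗ g) :
    NodeConditions α β (fun e => c (startNode e) * x₀ e) (fun e => c (endNode e) * xₗ e)
      (fun e => c (startNode e) * d₀ e) (fun e => c (endNode e) * dₗ e) (c * g) where
  start e := by rw [h.start, Pi.mul_apply, mul_left_comm]
  finish e := by rw [h.finish, Pi.mul_apply, mul_left_comm]
  flux p := by rw [netFlux_mul, h.flux, Pi.mul_apply, mul_left_comm]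

theorem exists_nodeConditions_mul_iff {x₀ xₗ d₀ dₗ : Edge → ℂ} {c : ℤ × ℤ → ℂ}
    (hc : ∀ p, c p ≠ 0) :
    (∃ g, NodeConditions α β (fun e => c (startNode e) * x₀ e) (fun e => c (endNode e) * xₗ e)
      (fun e => c (startNode e) * d₀ e) (fun e => c (endNode e) * dₗ e) g) ↔
    ∃ g, NodeConditions α β x₀ xₗ d₀ dₗ g :=
  ⟨fun ⟨g, h⟩ => ⟨c⁻¹ * g, by
    simpa only [Pi.inv_apply, inv_mul_cancel_left₀ (hc _)] using h.mul c⁻¹⟩,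
    fun ⟨g, h⟩ => ⟨c * g, h.mul c⟩⟩

end VertexConditions

/-! ### The gauge transformation of the lattice -/

section Gauge

variable {l : ℝ} (F : PeriodicMagneticField l)

theorem continuous_edgePotential (e : Edge) : Continuous (F.edgePotential e) := by
  have hA₁ := F.A₁_continuous
  have hA₂ := F.A₂_continuous
  obtain ⟨m, n, _ | _⟩ := e <;>
  · simp only [PeriodicMagneticField.edgePotential, PeriodicMagneticField.potential]
    fun_prop

/-- The gauge phase at the nodes. -/
def nodePhase (p : ℤ × ℤ) : ℝ :=
  p.1 * (∫ t in (0 : ℝ)..l, F.A₁ (t, 0)) + p.2 * ∫ t in (0 : ℝ)..l, F.A₂ (0, t)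

/-- The gauge phase on the edges, a primitive of the magnetic potential. -/
def edgePhase (e : Edge) (t : ℝ) : ℝ :=
  nodePhase F (startNode e) + ∫ s in (0 : ℝ)..t, F.edgePotential e s

theorem hasDerivAt_edgePhase (e : Edge) (t : ℝ) :
    HasDerivAt (edgePhase F e) (F.edgePotential e t) t :=
  ((continuous_edgePotential F e).integral_hasStrictDerivAt 0 t).hasDerivAt.const_add _

theorem continuous_edgePhase (e : Edge) : Continuous (edgePhase F e) :=
  continuous_iff_continuousAt.2 fun t => (hasDerivAt_edgePhase F e t).continuousAt

theorem edgePhase_start (e : Edge) : edgePhase F e 0 = nodePhase F (startNode e) := by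
  rw [edgePhase, intervalIntegral.integral_same, add_zero]

theorem edgePhase_end (e : Edge) :
    edgePhase F e l = nodePhase F (endNode e) - peierlsPhase F.theta e := by
  have hA₁ : Continuous fun t => F.A₁ (t, 0) := F.A₁_continuous.comp (by fun_prop)
  have hA₂ : Continuous fun t => F.A₂ (0, t) := F.A₂_continuous.comp (by fun_prop)
  obtain ⟨m, n, _ | _⟩ := e
  · simp only [edgePhase, F.edgePotential_right, nodePhase, startNode, endNode, peierlsPhase,
      PeriodicMagneticField.theta]
    rw [intervalIntegral.integral_add (by simp) (hA₁.intervalIntegrable _ _),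
      intervalIntegral.integral_const, smul_eq_mul]
    push_cast
    ring
  · simp only [edgePhase, F.edgePotential_up, nodePhase, startNode, endNode, peierlsPhase,
      PeriodicMagneticField.theta]
    rw [intervalIntegral.integral_add (by simp) (hA₂.intervalIntegrable _ _),
      intervalIntegral.integral_const, smul_eq_mul]
    push_cast
    ring

theorem phaseMul_edgePhase_start (e : Edge) (φ : ℝ → ℂ) : phaseMul (edgePhase F e) φ 0
    = Complex.exp (Complex.I * nodePhase F (startNode e)) * φ 0 := by
  rw [phaseMul, edgePhase_start]

theorem phaseMul_edgePhase_end (e : Edge) (φ : ℝ → ℂ) : phaseMul (edgePhase F e) φ l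
    = Complex.exp (Complex.I * nodePhase F (endNode e)) * ((peierlsFactor F.theta e)⁻¹ * φ l) := by
  rw [phaseMul, edgePhase_end, ← mul_assoc, peierlsFactor, ← Complex.exp_neg, ← Complex.exp_add]
  push_cast
  rw [mul_sub, sub_eq_add_neg]

theorem vertexConditions_phaseMul_iff (hl : 0 < l) {α β : ℝ} (hβ : β ≠ 0) {φ : Edge → ℝ → ℂ}
    (hφ : ∀ e, MemH2 l (φ e)) :
    VertexConditions F α β (fun e => phaseMul (edgePhase F e) (φ e)) ↔
      ∃ g, NodeConditions α β (fun e => φ e 0) (fun e => (peierlsFactor F.theta e)⁻¹ * φ e l)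
        (fun e => edgeDeriv l (φ e) 0)
        (fun e => (peierlsFactor F.theta e)⁻¹ * edgeDeriv l (φ e) l) g := by
  rw [vertexConditions_iff hβ]
  simp only [covDeriv_phaseMul hl (hasDerivAt_edgePhase F _ _) (hφ _) (left_mem_Icc.2 hl.le),
    covDeriv_phaseMul hl (hasDerivAt_edgePhase F _ _) (hφ _) (right_mem_Icc.2 hl.le),
    phaseMul_edgePhase_start, phaseMul_edgePhase_end]
  exact exists_nodeConditions_mul_iff (c := fun p => Complex.exp (Complex.I * nodePhase F p))
    fun p => Complex.exp_ne_zero _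

/-- The gauge transformation of the lattice: multiplication by `exp (i edgePhase)` on every edge. -/
def gauge : LatticeSpace l ≃L[ℂ] LatticeSpace l :=
  .equivOfInverse
    (weightedComposition (C := 1) ENNReal.ofNat_ne_top (encard_fiber_le_one Function.injective_id)
      fun e => norm_phaseOperator_le l (continuous_edgePhase F e))
    (weightedComposition (C := 1) ENNReal.ofNat_ne_top (encard_fiber_le_one Function.injective_id)
      fun e => norm_phaseOperator_le l (continuous_edgePhase F e).neg)
    (fun f => lp.ext <| funext fun e =>
      phaseOperator_neg_phaseOperator (continuous_edgePhase F e) (f e))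
    (fun f => lp.ext <| funext fun e =>
      phaseOperator_phaseOperator_neg (continuous_edgePhase F e) (f e))

theorem coeFn_gauge (f : LatticeSpace l) (e : Edge) :
    gauge F f e =ᵐ[edgeMeasure l] phaseMul (edgePhase F e) (f e) :=
  coeFn_phaseOperator (continuous_edgePhase F e) (f e)

theorem gauge_ae_eq_phaseMul_iff (f : LatticeSpace l) (e : Edge) (φ : ℝ → ℂ) :
    gauge F f e =ᵐ[edgeMeasure l] phaseMul (edgePhase F e) φ ↔ f e =ᵐ[edgeMeasure l] φ := by
  constructor
  · intro h
    filter_upwards [h, coeFn_gauge F f e] with t hφt hft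
    exact mul_left_cancel₀ (Complex.exp_ne_zero _) (hft.symm.trans hφt)
  · intro h
    filter_upwards [h, coeFn_gauge F f e] with t hφt hft
    rw [hft, phaseMul, hφt, phaseMul]

theorem gauge_mem_hamiltonian_graph_iff (hl : 0 < l) {V : ℝ → ℝ} {α β : ℝ} (hβ : β ≠ 0)
    (f k : LatticeSpace l) :
    (gauge F f, gauge F k) ∈ (hamiltonian hl F V α β).graph ↔ ∃ φ : Edge → ℝ → ℂ,
      (∀ e, MemH2 l (φ e)) ∧
      (∃ g, NodeConditions α β (fun e => φ e 0) (fun e => (peierlsFactor F.theta e)⁻¹ * φ e l)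
        (fun e => edgeDeriv l (φ e) 0)
        (fun e => (peierlsFactor F.theta e)⁻¹ * edgeDeriv l (φ e) l) g) ∧
      (∀ e, f e =ᵐ[edgeMeasure l] φ e) ∧
      ∀ e, k e =ᵐ[edgeMeasure l] schrodinger l V (φ e) := by
  have hpair : ∀ φ : Edge → ℝ → ℂ, (∀ e, MemH2 l (φ e)) → ∀ e,
      (gauge F k e =ᵐ[edgeMeasure l] magneticSchrodinger l (F.edgePotential e) V
        (phaseMul (edgePhase F e) (φ e)) ↔ k e =ᵐ[edgeMeasure l] schrodinger l V (φ e)) :=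
    fun φ hφ e => by
      rw [← gauge_ae_eq_phaseMul_iff F k e (schrodinger l V (φ e))]
      have hgauge := magneticSchrodinger_phaseMul (V := V) hl (hasDerivAt_edgePhase F e) (hφ e)
      exact ⟨fun h => h.trans hgauge, fun h => h.trans hgauge.symm⟩
  rw [hamiltonian_graph]
  constructor
  · rintro ⟨u, hu, hvertex, hf, hk⟩
    obtain ⟨φ, hφ, rfl⟩ : ∃ φ : Edge → ℝ → ℂ, (∀ e, MemH2 l (φ e)) ∧
        (fun e => phaseMul (edgePhase F e) (φ e)) = u :=
      ⟨fun e => phaseMul (-edgePhase F e) (u e),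
        fun e => (hu e).phaseMul hl (fun t => (hasDerivAt_edgePhase F e t).neg)
          (F.memH1_edgePotential e).neg,
        funext fun e => phaseMul_phaseMul_neg _ _⟩
    exact ⟨φ, hφ, (vertexConditions_phaseMul_iff F hl hβ hφ).1 hvertex,
      fun e => (gauge_ae_eq_phaseMul_iff F f e _).1 (hf e), fun e => (hpair φ hφ e).1 (hk e)⟩
  · rintro ⟨φ, hφ, hnode, hf, hk⟩
    exact ⟨fun e => phaseMul (edgePhase F e) (φ e),
      fun e => (hφ e).phaseMul hl (hasDerivAt_edgePhase F e) (F.memH1_edgePotential e),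
      (vertexConditions_phaseMul_iff F hl hβ hφ).2 hnode,
      fun e => (gauge_ae_eq_phaseMul_iff F f e _).2 (hf e), fun e => (hpair φ hφ e).2 (hk e)⟩

end Gauge

/-! ### Krein's formula on the lattice -/

section BoundaryOperators

variable {l β θ : ℝ}

theorem encard_fiber_le_two {α β : Type*} {σ : α → β} {b : β} {x y : α}
    (h : σ ⁻¹' {b} ⊆ {x, y}) : (σ ⁻¹' {b}).encard ≤ (2 : ℕ) := by
  refine (encard_le_encard h).trans ((encard_insert_le _ _).trans_eq ?_)
  rw [encard_singleton, Nat.cast_ofNat, one_add_one_eq_two]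

theorem encard_startNode_fiber_le (p : ℤ × ℤ) : (startNode ⁻¹' {p}).encard ≤ (2 : ℕ) :=
  encard_fiber_le_two (x := (p.1, p.2, .right)) (y := (p.1, p.2, .up)) <| by
    rintro ⟨m, n, _ | _⟩ rfl <;> simp [startNode]

theorem encard_endNode_fiber_le (p : ℤ × ℤ) : (endNode ⁻¹' {p}).encard ≤ (2 : ℕ) :=
  encard_fiber_le_two (x := (p.1 - 1, p.2, .right)) (y := (p.1, p.2 - 1, .up)) <| by
    rintro ⟨m, n, _ | _⟩ rfl <;> simp [endNode]

theorem norm_edgeWeight_smul_toSpanSingleton_le (β : ℝ) (v : EdgeSpace l) (e : Edge) :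
    ‖edgeWeight β e • ContinuousLinearMap.toSpanSingleton ℂ v‖
      ≤ ((1 + ‖β‖₊) * ‖v‖₊ : NNReal) := by
  rw [norm_smul, ContinuousLinearMap.norm_toSpanSingleton]
  exact mul_le_mul_of_nonneg_right (nnnorm_edgeWeight_le β e) (norm_nonneg v)

/-- Extension of node values `g` to the edges: the edge functions are combinations of two fixed
functions `v` and `w`, whose coefficients are the boundary values that `NodeConditions` prescribes
at the starting point and, after the gauge transformation, at the end point of the edge. -/
def nodeExtension (β θ : ℝ) (v w : EdgeSpace l) : L2Z2 →L[ℂ] LatticeSpace l :=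
  weightedComposition (p := 2) (E := fun _ => ℂ) (σ := startNode) ENNReal.ofNat_ne_top
      encard_startNode_fiber_le (norm_edgeWeight_smul_toSpanSingleton_le β v)
    + weightedComposition (p := 2) (E := fun _ => ℂ) (σ := endNode)
      (B := fun e => peierlsFactor θ e • edgeWeight β e •
        ContinuousLinearMap.toSpanSingleton ℂ w) (C := (1 + ‖β‖₊) * ‖w‖₊) ENNReal.ofNat_ne_top
      encard_endNode_fiber_le fun e => by
        rw [norm_smul, norm_peierlsFactor, one_mul]
        exact norm_edgeWeight_smul_toSpanSingleton_le β w e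

theorem nodeExtension_apply (v w : EdgeSpace l) (g : L2Z2) (e : Edge) :
    nodeExtension β θ v w g e = (edgeWeight β e * g (startNode e)) • v
      + (edgeWeight β e * (peierlsFactor θ e * g (endNode e))) • w := by
  rw [nodeExtension, add_apply, lp.coeFn_add, Pi.add_apply,
    weightedComposition_apply, weightedComposition_apply]
  simp only [smul_apply, ContinuousLinearMap.toSpanSingleton_apply, smul_smul, mul_assoc,
    mul_left_comm (peierlsFactor θ e)]

/-- The values of a bounded family of functionals `Λ` on the edge functions, as a function of the
nodes `p`: the functional at `p` is the one of the edge `σ p`. -/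
def edgeFunctionals {Λ : Edge → EdgeSpace l →L[ℂ] ℂ} {C : NNReal} (hΛ : ∀ e, ‖Λ e‖ ≤ C)
    {σ : ℤ × ℤ → Edge} (hσ : Function.Injective σ) : LatticeSpace l →L[ℂ] L2Z2 :=
  weightedComposition (p := 2) (E := fun _ => EdgeSpace l) (B := fun p => Λ (σ p))
    ENNReal.ofNat_ne_top (encard_fiber_le_one hσ) fun p => hΛ (σ p)

theorem injective_outgoingEdge (d : Dir) :
    Function.Injective fun p : ℤ × ℤ => ((p.1, p.2, d) : Edge) := fun p q h => by
  simpa [Prod.ext_iff] using h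

theorem injective_incomingEdge (d : Dir) (a b : ℤ) :
    Function.Injective fun p : ℤ × ℤ => ((p.1 - a, p.2 - b, d) : Edge) := fun p q h => by
  simpa [Prod.ext_iff] using h

/-- The net flux of the data obtained by applying the functionals `Λ` at the starting points and
`Λ'` at the end points of the edges. -/
def netFluxOperator (β : ℝ) {Λ Λ' : Edge → EdgeSpace l →L[ℂ] ℂ} {C C' : NNReal}
    (hΛ : ∀ e, ‖Λ e‖ ≤ C) (hΛ' : ∀ e, ‖Λ' e‖ ≤ C') : LatticeSpace l →L[ℂ] L2Z2 :=
  edgeFunctionals hΛ (injective_outgoingEdge .right)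
    + (β : ℂ) • edgeFunctionals hΛ (injective_outgoingEdge .up)
    - edgeFunctionals hΛ' (injective_incomingEdge .right 1 0)
    - (β : ℂ) • edgeFunctionals hΛ' (injective_incomingEdge .up 0 1)

theorem netFluxOperator_apply {Λ Λ' : Edge → EdgeSpace l →L[ℂ] ℂ} {C C' : NNReal}
    (hΛ : ∀ e, ‖Λ e‖ ≤ C) (hΛ' : ∀ e, ‖Λ' e‖ ≤ C') (f : LatticeSpace l) (p : ℤ × ℤ) :
    netFluxOperator β hΛ hΛ' f p = netFlux β (fun e => Λ e (f e)) (fun e => Λ' e (f e)) p := by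
  change Λ _ (f _) + β * Λ _ (f _) - Λ' _ (f (_, p.2 - 0, _)) - β * Λ' _ (f (p.1 - 0, _)) = _
  simp only [sub_zero, netFlux]

/-- The contribution of an inhomogeneity to the flux condition at the nodes: the functions `v` and
`w` represent the derivatives at the starting point and, up to sign, at the end point of an edge. -/
def nodeFlux (β θ : ℝ) (v w : EdgeSpace l) : LatticeSpace l →L[ℂ] L2Z2 :=
  netFluxOperator β (Λ := fun _ => pairing l v) (C := ‖pairing l v‖₊) (C' := ‖pairing l w‖₊)
    (Λ' := fun e => -((peierlsFactor θ e)⁻¹ • pairing l w)) (fun _ => le_rfl) fun e => by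
      rw [norm_neg, norm_smul, norm_inv, norm_peierlsFactor, inv_one, one_mul, coe_nnnorm]

theorem nodeFlux_apply (v w : EdgeSpace l) (h : LatticeSpace l) (p : ℤ × ℤ) :
    nodeFlux β θ v w h p = netFlux β (fun e => pairing l v (h e))
      (fun e => -((peierlsFactor θ e)⁻¹ * pairing l w (h e))) p :=
  netFluxOperator_apply _ _ h p

/-- The pairing of a fixed function `χ` with the horizontal edge functions, as a function of the
starting points. It recovers the node values from `nodeExtension`. -/
def nodeValue (χ : EdgeSpace l) : LatticeSpace l →L[ℂ] L2Z2 :=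
  edgeFunctionals (Λ := fun _ => pairing l χ) (C := ‖pairing l χ‖₊) (fun _ => le_rfl)
    (injective_outgoingEdge .right)

theorem nodeValue_apply (χ : EdgeSpace l) (f : LatticeSpace l) (p : ℤ × ℤ) :
    nodeValue χ f p = pairing l χ (f (p.1, p.2, .right)) :=
  rfl

theorem nodeValue_eq {v w χ : EdgeSpace l} (hv : pairing l v χ = 1) (hw : pairing l w χ = 0)
    {f : LatticeSpace l} {g c : ℤ × ℤ → ℂ}
    (hf : ∀ p, f (p.1, p.2, .right) = g p • v + c p • w) (p : ℤ × ℤ) : nodeValue χ f p = g p := by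
  rw [nodeValue_apply, hf, map_add, map_smul, map_smul, pairing_comm χ v, pairing_comm χ w, hv, hw,
    smul_zero, add_zero, smul_eq_mul, mul_one]

theorem nodeExtension_injective {v w χ : EdgeSpace l} (hv : pairing l v χ = 1)
    (hw : pairing l w χ = 0) : Function.Injective (nodeExtension β θ v w) :=
  Function.LeftInverse.injective (g := nodeValue χ) fun g => lp.ext <| funext <|
    nodeValue_eq hv hw fun p => by
      rw [nodeExtension_apply]
      simp only [edgeWeight, one_mul, startNode]
      rfl

theorem nodeFlux_surjective {v w χ : EdgeSpace l} (hv : pairing l v χ = 1)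
    (hw : pairing l w χ = 0) : Function.Surjective (nodeFlux β θ v w) := fun g => by
  have hne : (1 + (β : ℂ) ^ 2) ≠ 0 := by exact_mod_cast (by positivity : 1 + β ^ 2 ≠ 0)
  refine ⟨nodeExtension β θ χ 0 ((1 + (β : ℂ) ^ 2)⁻¹ • g), lp.ext <| funext fun p => ?_⟩
  simp only [nodeFlux_apply, nodeExtension_apply, smul_zero, add_zero, map_smul, hv, hw, netFlux,
    edgeWeight, startNode, lp.coeFn_smul, Pi.smul_apply, smul_eq_mul]
  field_simp
  ring

end BoundaryOperators

section KreinFormula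

variable {l : ℝ} {V : ℝ → ℝ} {α β θ : ℝ} {z : ℂ}

/-- The operator that the flux condition induces on the node values. -/
def vertexOperator (l : ℝ) (V : ℝ → ℝ) (α β θ : ℝ) (z : ℂ) : L2Z2 →L[ℂ] L2Z2 :=
  ((1 + (β : ℂ) ^ 2) * (kreinMatrix l V z 0 0 + kreinMatrix l V z 1 1) - (α : ℂ)) •
    (1 : L2Z2 →L[ℂ] L2Z2) + kreinMatrix l V z 0 1 • discreteMagneticLaplacian θ β

theorem vertexOperator_eq_netFlux (g : L2Z2) (p : ℤ × ℤ) :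
    vertexOperator l V α β θ z g p
      = netFlux β
        (fun e => kreinMatrix l V z 0 0 * (edgeWeight β e * g (startNode e))
          + kreinMatrix l V z 1 0 * (edgeWeight β e * (peierlsFactor θ e * g (endNode e))))
        (fun e => -((peierlsFactor θ e)⁻¹ * (kreinMatrix l V z 0 1 *
            (edgeWeight β e * g (startNode e)) + kreinMatrix l V z 1 1 *
              (edgeWeight β e * (peierlsFactor θ e * g (endNode e)))))) p - α * g p := by
  have hsymm : kreinMatrix l V z 1 0 = kreinMatrix l V z 0 1 := by simp [kreinMatrix]
  have hcancel : ∀ e x, (peierlsFactor θ e)⁻¹ * (edgeWeight β e * (peierlsFactor θ e * x))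
      = edgeWeight β e * x := fun e x => by
    rw [mul_left_comm, inv_mul_cancel_left₀ (peierlsFactor_ne_zero θ e)]
  have happly : vertexOperator l V α β θ z g p
      = ((1 + (β : ℂ) ^ 2) * (kreinMatrix l V z 0 0 + kreinMatrix l V z 1 1) - α) * g p
        + kreinMatrix l V z 0 1 * discreteMagneticLaplacian θ β g p := rfl
  rw [happly, discreteMagneticLaplacian_eq_netFlux, hsymm]
  simp only [mul_add, mul_left_comm (peierlsFactor θ _)⁻¹ (kreinMatrix l V z _ _), hcancel]
  simp only [netFlux, edgeWeight, startNode, endNode, sub_add_cancel]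
  ring

theorem nodeConditions_iff_vertexOperator (hl : 0 < l) (hV : MemLp V 2 (edgeMeasure l))
    (hz : z ∈ resolventSet (dirichletOperator l V)) {h : LatticeSpace l} {φ : Edge → ℝ → ℂ}
    (hφ : ∀ e, IsEdgeSolution l V z (h e) (φ e)) (g : L2Z2) :
    NodeConditions α β (fun e => φ e 0) (fun e => (peierlsFactor θ e)⁻¹ * φ e l)
        (fun e => edgeDeriv l (φ e) 0) (fun e => (peierlsFactor θ e)⁻¹ * edgeDeriv l (φ e) l) g ↔
      (∀ e, φ e 0 = edgeWeight β e * g (startNode e)) ∧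
      (∀ e, φ e l = edgeWeight β e * (peierlsFactor θ e * g (endNode e))) ∧
      vertexOperator l V α β θ z g
        + nodeFlux β θ (leftMode hl hV hz) (rightMode hl hV hz) h = 0 := by
  have hend : ∀ e, (peierlsFactor θ e)⁻¹ * φ e l = edgeWeight β e * g (endNode e) ↔
      φ e l = edgeWeight β e * (peierlsFactor θ e * g (endNode e)) := fun e => by
    rw [inv_mul_eq_iff_eq_mul₀ (peierlsFactor_ne_zero θ e), mul_left_comm]
  have hflux (hφ0 : ∀ e, φ e 0 = edgeWeight β e * g (startNode e))
      (hφl : ∀ e, φ e l = edgeWeight β e * (peierlsFactor θ e * g (endNode e))) (p : ℤ × ℤ) :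
      netFlux β (fun e => edgeDeriv l (φ e) 0)
          (fun e => (peierlsFactor θ e)⁻¹ * edgeDeriv l (φ e) l) p - α * g p
        = vertexOperator l V α β θ z g p
          + nodeFlux β θ (leftMode hl hV hz) (rightMode hl hV hz) h p := by
    simp only [(hφ _).edgeDeriv_start hl hV hz, (hφ _).edgeDeriv_end hl hV hz, hφ0, hφl, mul_neg,
      mul_add, neg_add, netFlux_add, nodeFlux_apply, vertexOperator_eq_netFlux]
    ring
  constructor
  · rintro ⟨hstart, hfinish, hnode⟩
    have hφl := fun e => (hend e).1 (hfinish e)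
    exact ⟨hstart, hφl, lp.ext <| funext fun p =>
      (hflux hstart hφl p).symm.trans (sub_eq_zero.2 (hnode p))⟩
  · rintro ⟨hφ0, hφl, hzero⟩
    exact ⟨hφ0, fun e => (hend e).2 (hφl e), fun p => sub_eq_zero.1 <|
      (hflux hφ0 hφl p).trans (congrArg (fun x : L2Z2 => x p) hzero)⟩

/-- The resolvent of the decoupled lattice: the Dirichlet resolvent on every edge. -/
def decoupledResolvent (hz : z ∈ resolventSet (dirichletOperator l V)) :
    LatticeSpace l →L[ℂ] LatticeSpace l :=
  weightedComposition (p := 2) (E := fun _ : Edge => EdgeSpace l) (σ := id)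
    (B := fun _ => resolventOperator hz) (C := ‖resolventOperator hz‖₊)
    ENNReal.ofNat_ne_top (encard_fiber_le_one Function.injective_id) fun _ => le_rfl

theorem decoupledResolvent_apply (hz : z ∈ resolventSet (dirichletOperator l V))
    (h : LatticeSpace l) (e : Edge) : decoupledResolvent hz h e = resolventOperator hz (h e) :=
  rfl

theorem exists_nodeConditions_iff_kreinFormula (hl : 0 < l) (hV : MemLp V 2 (edgeMeasure l))
    (hz : z ∈ resolventSet (dirichletOperator l V)) (f h : LatticeSpace l) :
    (∃ φ : Edge → ℝ → ℂ, (∀ e, IsEdgeSolution l V z (h e) (φ e)) ∧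
      (∃ g, NodeConditions α β (fun e => φ e 0) (fun e => (peierlsFactor θ e)⁻¹ * φ e l)
        (fun e => edgeDeriv l (φ e) 0)
        (fun e => (peierlsFactor θ e)⁻¹ * edgeDeriv l (φ e) l) g) ∧
      ∀ e, f e =ᵐ[edgeMeasure l] φ e) ↔
    ∃ g, f = decoupledResolvent hz h
        + nodeExtension β θ (leftMode hl hV hz) (rightMode hl hV hz) g ∧
      vertexOperator l V α β θ z g
        + nodeFlux β θ (leftMode hl hV hz) (rightMode hl hV hz) h = 0 := by
  constructor
  · rintro ⟨φ, hφ, ⟨c, hc⟩, hf⟩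
    have hfe : ∀ e, f e - decoupledResolvent hz h e
        = φ e 0 • leftMode hl hV hz + φ e l • rightMode hl hV hz := fun e =>
      sub_eq_iff_eq_add'.2 (Lp.ext ((hf e).trans ((hφ e).ae_eq hl hV hz).symm))
    obtain ⟨χ, hleft, hright⟩ := exists_pairing_modes_eq hl hV hz
    -- Being the pairing of `χ` with `f - R h`, the node values are square summable.
    obtain ⟨g, rfl⟩ : ∃ g : L2Z2, ⇑g = c :=
      ⟨nodeValue χ (f - decoupledResolvent hz h), funext fun p =>
        (nodeValue_eq hleft hright (fun p => hfe (p.1, p.2, .right)) p).trans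
          ((hc.start _).trans (one_mul _))⟩
    obtain ⟨hφ0, hφl, hzero⟩ := (nodeConditions_iff_vertexOperator hl hV hz hφ g).1 hc
    refine ⟨g, lp.ext <| funext fun e => ?_, hzero⟩
    rw [lp.coeFn_add, Pi.add_apply, decoupledResolvent_apply, nodeExtension_apply, ← hφ0,
      ← hφl, ← hfe, decoupledResolvent_apply, add_sub_cancel]
  · rintro ⟨g, rfl, hzero⟩
    choose φ hφ hφ0 hφl using fun e => exists_isEdgeSolution_boundary_eq hl hV hz (h e)
      (edgeWeight β e * g (startNode e)) (edgeWeight β e * (peierlsFactor θ e * g (endNode e)))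
    refine ⟨φ, hφ, ⟨g, (nodeConditions_iff_vertexOperator hl hV hz hφ g).2 ⟨hφ0, hφl, hzero⟩⟩,
      fun e => ?_⟩
    rw [lp.coeFn_add, Pi.add_apply, decoupledResolvent_apply, nodeExtension_apply, ← hφ0, ← hφl]
    exact (hφ e).ae_eq hl hV hz

theorem gauge_mem_hamiltonian_graph_iff_kreinFormula (hl : 0 < l) (F : PeriodicMagneticField l)
    (hV : MemLp V 2 (edgeMeasure l)) (hβ : β ≠ 0)
    (hz : z ∈ resolventSet (dirichletOperator l V)) (f h : LatticeSpace l) :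
    (gauge F f, gauge F (h + z • f)) ∈ (hamiltonian hl F V α β).graph ↔
    ∃ g, f = decoupledResolvent hz h
        + nodeExtension β F.theta (leftMode hl hV hz) (rightMode hl hV hz) g ∧
      vertexOperator l V α β F.theta z g
        + nodeFlux β F.theta (leftMode hl hV hz) (rightMode hl hV hz) h = 0 := by
  rw [gauge_mem_hamiltonian_graph_iff F hl hβ, ← exists_nodeConditions_iff_kreinFormula]
  refine exists_congr fun φ => ⟨?_, ?_⟩
  · rintro ⟨hφ, hnode, hf, hk⟩
    exact ⟨fun e => ⟨hφ e, (ae_add_smul_eq_schrodinger_iff (hf e)).1 (hk e)⟩, hnode, hf⟩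
  · rintro ⟨hφ, hnode, hf⟩
    exact ⟨fun e => (hφ e).1, hnode, hf,
      fun e => (ae_add_smul_eq_schrodinger_iff (hf e)).2 (hφ e).2⟩

theorem mem_resolventSet_hamiltonian_iff (hl : 0 < l) (F : PeriodicMagneticField l)
    (hV : MemLp V 2 (edgeMeasure l)) (α : ℝ) (hβ : β ≠ 0)
    (hz : z ∈ resolventSet (dirichletOperator l V)) :
    z ∈ resolventSet (hamiltonian hl F V α β) ↔ IsUnit (vertexOperator l V α β F.theta z) := by
  obtain ⟨χ, hleft, hright⟩ := exists_pairing_modes_eq hl hV hz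
  exact mem_resolventSet_iff_isUnit_of_conj (gauge F) (decoupledResolvent hz)
    (nodeExtension β F.theta (leftMode hl hV hz) (rightMode hl hV hz))
    (nodeFlux β F.theta (leftMode hl hV hz) (rightMode hl hV hz)) _
    (nodeExtension_injective hleft hright) (nodeFlux_surjective hleft hright)
    (gauge_mem_hamiltonian_graph_iff_kreinFormula hl F hV hβ hz)

end KreinFormula

end QuantumGraph

end

theorem mainTheorem7_general (l : ℝ) (hl : 0 < l) (F : QuantumGraph.PeriodicMagneticField l)
    (V : ℝ → ℝ) (hV : MemLp V 2 (QuantumGraph.edgeMeasure l)) (α β : ℝ) (hβ : β ≠ 0) (z : ℂ)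
    (hz : z ∉ QuantumGraph.unboundedSpectrum (QuantumGraph.dirichletOperator l V)) :
    z ∈ QuantumGraph.unboundedSpectrum (QuantumGraph.hamiltonian hl F V α β) ↔
      (0 : ℂ) ∈ spectrum ℂ
        (((1 + (β : ℂ) ^ 2) *
            (QuantumGraph.kreinMatrix l V z 0 0 + QuantumGraph.kreinMatrix l V z 1 1) - (α : ℂ)) •
            (1 : QuantumGraph.L2Z2 →L[ℂ] QuantumGraph.L2Z2)
          + QuantumGraph.kreinMatrix l V z 0 1 •
            QuantumGraph.discreteMagneticLaplacian F.theta β) := by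
  rw [spectrum.zero_mem_iff, QuantumGraph.unboundedSpectrum, mem_compl_iff]
  exact not_congr <|
    QuantumGraph.mem_resolventSet_hamiltonian_iff hl F hV α hβ (notMem_compl_iff.1 hz)

theorem mainTheorem7 (l : ℝ) (hl : 0 < l) (F : QuantumGraph.PeriodicMagneticField l)
    (V : ℝ → ℝ) (hV : MemLp V 2 (QuantumGraph.edgeMeasure l)) (α β : ℝ) (hβ : β ≠ 0) (z : ℝ)
    (hz : (z : ℂ) ∉ QuantumGraph.unboundedSpectrum (QuantumGraph.dirichletOperator l V)) :
    (z : ℂ) ∈ QuantumGraph.unboundedSpectrum (QuantumGraph.hamiltonian hl F V α β) ↔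
      (0 : ℂ) ∈ spectrum ℂ
        (((1 + (β : ℂ) ^ 2) * (QuantumGraph.kreinMatrix l V z 0 0 + QuantumGraph.kreinMatrix l V z 1 1)
            - (α : ℂ)) • (1 : QuantumGraph.L2Z2 →L[ℂ] QuantumGraph.L2Z2)
          + QuantumGraph.kreinMatrix l V z 0 1 •
            QuantumGraph.discreteMagneticLaplacian F.theta β) :=
  mainTheorem7_general l hl F V hV α β hβ z hz
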